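/- Let $\mathbb D=\{z\in\mathbb C:|z|<1\}$, let $\alpha>1$, $s>t>0$, $p>1$, and let $\mu$ be a positive Borel measure on $\mathbb D$. For a subarc $I\subseteq\partial\mathbb D$ let $|I|\in(0,1]$ be its normalized arc length (so that $|\partial\mathbb D|=1$), and let $$S(I)=\Big\{z\in\mathbb D:\ 1-|I|<|z|<1,\ \tfrac{z}{|z|}\in I\Big\}$$ be the Carleson tent over $I$. Let $F(p,p\alpha-2,t)$ be the space of all holomorphic functions $f$ on $\mathbb D$ with $$\|f\|_{F(p,p\alpha-2,t)}=|f(0)|+\sup_{a\in\mathbb D}\left(\int_{\mathbb D}|f'(z)|^p(1-|z|^2)^{p\alpha-2}(1-|\varphi_a(z)|^2)^t\,dA(z)\right)^{1/p}<\infty,\qquad \varphi_a(z)=\frac{a-z}{1-\overline a z},$$ where $dA$ is Lebesgue measure on $\mathbb D$, and let $\mathfrak T^\infty_{s,p}(\mu)$ be the space of all holomorphic functions $f$ on $\mathbb D$ with $$\|f\|_{\mathfrak T^\infty_{s,p}(\mu)}=\left(\sup_{I\subseteq\partial\mathbb D}\frac1{|I|^s}\int_{S(I)}|f|^p\,d\mu\right)^{1/p}<\infty.$$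 Then the identity map $F(p,p\alpha-2,t)\to\mathfrak T^\infty_{s,p}(\mu)$ is well defined and bounded (that is, $F(p,p\alpha-2,t)\subseteq\mathfrak T^\infty_{s,p}(\mu)$ and there is a constant $C<\infty$ with $\|f\|_{\mathfrak T^\infty_{s,p}(\mu)}\le C\|f\|_{F(p,p\alpha-2,t)}$ for all $f\in F(p,p\alpha-2,t)$) if and only if $\mu$ is an $[s+p(\alpha-1)]$-Carleson measure, that is, $$\sup_{I\subseteq\partial\mathbb D}\frac{\mu(S(I))}{|I|^{s+p(\alpha-1)}}<\infty .$$ -/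

import Mathlib

noncomputable section

open scoped ENNReal NNReal

namespace CarlesonEmbedding

/-- The open unit disc. -/
def disc : Set ℂ := Metric.ball (0 : ℂ) 1

/-- The closed subarc of the unit circle with midpoint `exp (i θ)` and normalized length `h`
(the whole circle has length `1`), for `0 < h ≤ 1`. -/
def arc (θ h : ℝ) : Set ℂ :=
  (fun x : ℝ => Complex.exp (x * Complex.I)) '' Set.Icc (θ - Real.pi * h) (θ + Real.pi * h)

/-- The Carleson tent `S(I)` over the arc `I = arc θ h`, where `|I| = h`. -/
def tent (θ h : ℝ) : Set ℂ :=
  {z : ℂ | 1 - h < ‖z‖ ∧ ‖z‖ < 1 ∧ z / (‖z‖ : ℂ) ∈ arc θ h}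

/-- The disc automorphism `φ_a(z) = (a - z) / (1 - conj a * z)`. -/
def mobius (a z : ℂ) : ℂ := (a - z) / (1 - (starRingEnd ℂ) a * z)

/-- The norm of `F(p, q, t)`, with values in `[0, ∞]`:
`|f(0)| + sup_{a ∈ 𝔻} (∫_𝔻 |f'(z)|^p (1-|z|²)^q (1-|φ_a(z)|²)^t dA(z))^{1/p}`. -/
def fNorm (p q t : ℝ) (f : ℂ → ℂ) : ℝ≥0∞ :=
  ‖f 0‖ₑ + ⨆ a ∈ disc,
    (∫⁻ z in disc, ENNReal.ofReal
      (‖deriv f z‖ ^ p * (1 - ‖z‖ ^ 2) ^ q * (1 - ‖mobius a z‖ ^ 2) ^ t)) ^ (1 / p)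

/-- The space `F(p, q, t)` of holomorphic functions on the disc with finite norm. A function on
the disc is represented by any function on `ℂ` extending it; only its values on the disc
matter. -/
def fSpace (p q t : ℝ) : Set (ℂ → ℂ) :=
  {f | DifferentiableOn ℂ f disc ∧ fNorm p q t f < ∞}

/-- The tent space norm `(sup_I |I|^{-s} ∫_{S(I)} |f|^p dμ)^{1/p}`, with values in `[0, ∞]`. -/
def tentNorm (s p : ℝ) (μ : MeasureTheory.Measure ℂ) (f : ℂ → ℂ) : ℝ≥0∞ :=
  (⨆ (θ : ℝ) (h ∈ Set.Ioc (0 : ℝ) 1),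
    (∫⁻ z in tent θ h, ‖f z‖ₑ ^ p ∂μ) / ENNReal.ofReal (h ^ s)) ^ (1 / p)

/-- The tent space of holomorphic functions on the disc with finite tent space norm. -/
def tentSpace (s p : ℝ) (μ : MeasureTheory.Measure ℂ) : Set (ℂ → ℂ) :=
  {f | DifferentiableOn ℂ f disc ∧ tentNorm s p μ f < ∞}

/-- The identity map from `F(p, q, t)` to the tent space is well defined and bounded. -/
def IsBoundedEmbedding (p q t s : ℝ) (μ : MeasureTheory.Measure ℂ) : Prop :=
  fSpace p q t ⊆ tentSpace s p μ ∧
    ∃ C : ℝ≥0, ∀ f ∈ fSpace p q t, tentNorm s p μ f ≤ C * fNorm p q t f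

/-- The Carleson norm `sup_I μ(S(I)) / |I|^r`, with values in `[0, ∞]`. -/
def carlesonNorm (r : ℝ) (μ : MeasureTheory.Measure ℂ) : ℝ≥0∞ :=
  ⨆ (θ : ℝ) (h ∈ Set.Ioc (0 : ℝ) 1), μ (tent θ h) / ENNReal.ofReal (h ^ r)

/-- `μ` is an `r`-Carleson measure. -/
def IsCarlesonMeasure (r : ℝ) (μ : MeasureTheory.Measure ℂ) : Prop :=
  carlesonNorm r μ < ∞

end CarlesonEmbedding

end

noncomputable section

open MeasureTheory Metric Set
open scoped ENNReal NNReal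

namespace CarlesonEmbedding

/-! Write `N` for the norm of `f` in `F(p, pα - 2, t)`, `σ = s + p(α - 1)` and `ε = s - t > 0`.

Sufficiency. For `z` in a tent of size `h`, with `ζ = z/|z|`, compare `f(z)` with the value `f((1 -
h)ζ)` at the bottom of the tent. Taking `a` at distance `h/2` from the circle in the norm shows that
`|f'|^p (1 - |w|)^(pα-2+t) dA` has mass `O(h^t N^p)` near an arc of length `h`
(`lintegral_cap_le_fNorm`). With the sub-mean value property this gives `|f'(z)| ≲ N (1 -
|z|)^(-α)`, and integration along radii gives `|f(z)| ≲ N (1 - |z|)^(1-α)` because `α > 1`. The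
bottom values thus contribute at most `h^(p(1-α)) N^p μ(S(I)) ≲ h^s N^p`.

For the difference, Hölder's inequality along the radius and the sub-mean value property on discs of
radius comparable to the distance to the circle give `h^ε` times an integral of `|f'(w)|^p (1 -
|w|)^(p-2-ε)` over `|z - w| < 3(1 - |w|)` (`enorm_sub_rpow_le_area`). Integrating in `z` against `μ`
first turns this condition into a factor `(1 - |w|)^σ`. Since `p - 2 - ε + σ = pα - 2 + t`, the mass
estimate applies and yields `h^ε h^t = h^s`. The strict inequality `t < s` is what lets the weighted
Hölder step converge.

Necessity. The functions `h (1 - conj b z)^(-α)` with `b = (1 - h/2) e^(iθ)` have bounded norm by a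
Forelli–Rudin estimate, and have modulus at least a constant times `h^(1-α)` on the tent. Testing
the embedding on them gives the Carleson condition. -/

/-! ### Arcs, tents and Carleson measures of balls -/

lemma norm_exp_mul_I_sub_exp_mul_I (x y : ℝ) :
    ‖Complex.exp (x * Complex.I) - Complex.exp (y * Complex.I)‖ = 2 * |Real.sin ((x - y) / 2)| := by
  have h : Complex.exp (x * Complex.I) - Complex.exp (y * Complex.I) =
      Complex.exp (y * Complex.I) * (Complex.exp (Complex.I * ((x - y : ℝ) : ℂ)) - 1) := by
    rw [mul_sub, ← Complex.exp_add]
    congr 2 <;> push_cast <;> ring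
  rw [h, norm_mul, Complex.norm_exp_ofReal_mul_I, one_mul, Complex.norm_exp_I_mul_ofReal_sub_one,
    norm_mul, Real.norm_eq_abs, Real.norm_eq_abs, abs_two]

lemma norm_exp_mul_I_sub_exp_mul_I_le (x y : ℝ) :
    ‖Complex.exp (x * Complex.I) - Complex.exp (y * Complex.I)‖ ≤ |x - y| := by
  rw [norm_exp_mul_I_sub_exp_mul_I]
  have := Real.abs_sin_le_abs (x := (x - y) / 2)
  rw [abs_div, abs_two] at this
  linarith

lemma abs_sub_le_norm_exp_sub_exp {x y : ℝ} (h : |x - y| ≤ Real.pi) :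
    |x - y| ≤ Real.pi / 2 * ‖Complex.exp (x * Complex.I) - Complex.exp (y * Complex.I)‖ := by
  rw [norm_exp_mul_I_sub_exp_mul_I]
  have h2 : |(x - y) / 2| ≤ Real.pi / 2 := by rw [abs_div, abs_two]; linarith
  have := Real.mul_abs_le_abs_sin h2
  rw [abs_div, abs_two] at this
  have hpi := Real.pi_pos
  rw [div_mul_eq_mul_div, div_le_iff₀ hpi] at this
  linarith

lemma norm_sub_div_norm {z : ℂ} (hz : z ≠ 0) (hz1 : ‖z‖ ≤ 1) : ‖z - z / (‖z‖ : ℂ)‖ = 1 - ‖z‖ := by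
  have h0 : (‖z‖ : ℂ) ≠ 0 := by simpa using hz
  have h1 : z - z / (‖z‖ : ℂ) = z / (‖z‖ : ℂ) * ((‖z‖ - 1 : ℝ) : ℂ) := by
    push_cast; field_simp
  rw [h1, norm_mul, norm_div, Complex.norm_real, Complex.norm_real, norm_norm,
    div_self (norm_ne_zero_iff.2 hz), one_mul, Real.norm_eq_abs, abs_of_nonpos (by linarith)]
  ring

lemma norm_div_norm {z : ℂ} (hz : z ≠ 0) : ‖z / (‖z‖ : ℂ)‖ = 1 := by
  rw [norm_div, Complex.norm_real, norm_norm, div_self (norm_ne_zero_iff.2 hz)]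

lemma ne_zero_of_mem_tent {θ h : ℝ} (hh : h ≤ 1) {z : ℂ} (hz : z ∈ tent θ h) : z ≠ 0 := by
  rintro rfl
  have := hz.1
  simp at this
  linarith

lemma norm_sub_lt_of_mem_tent {θ h : ℝ} (hh0 : 0 < h) (hh : h ≤ 1) {z : ℂ} (hz : z ∈ tent θ h) :
    ‖z - Complex.exp (θ * Complex.I)‖ < 5 * h ∧
      ‖z / (‖z‖ : ℂ) - Complex.exp (θ * Complex.I)‖ ≤ 4 * h := by
  have hz0 := ne_zero_of_mem_tent hh hz
  obtain ⟨h1, h2, x, hx, hxz⟩ := hz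
  have h3 : ‖z / (‖z‖ : ℂ) - Complex.exp (θ * Complex.I)‖ ≤ 4 * h := by
    rw [← hxz]
    refine (norm_exp_mul_I_sub_exp_mul_I_le x θ).trans ?_
    have h4 : |x - θ| ≤ Real.pi * h := abs_le.2 ⟨by linarith [hx.1], by linarith [hx.2]⟩
    exact h4.trans (by nlinarith [Real.pi_lt_four])
  refine ⟨?_, h3⟩
  calc ‖z - Complex.exp (θ * Complex.I)‖
      ≤ ‖z - z / (‖z‖ : ℂ)‖ + ‖z / (‖z‖ : ℂ) - Complex.exp (θ * Complex.I)‖ :=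
        norm_sub_le_norm_sub_add_norm_sub _ _ _
    _ < 5 * h := by rw [norm_sub_div_norm hz0 h2.le]; linarith

/-- Every point of the unit circle has an argument within `π` of a given one. -/
lemma exists_exp_eq_abs_sub_le {u : ℂ} (hu : ‖u‖ = 1) (θ : ℝ) :
    ∃ x : ℝ, Complex.exp (x * Complex.I) = u ∧ |x - θ| ≤ Real.pi := by
  refine ⟨(u * Complex.exp (-θ * Complex.I)).arg + θ, ?_, ?_⟩
  · have h1 : ‖u * Complex.exp (-θ * Complex.I)‖ = 1 := by
      rw [norm_mul, hu, ← Complex.ofReal_neg, Complex.norm_exp_ofReal_mul_I, one_mul]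
    have h2 := Complex.norm_mul_exp_arg_mul_I (u * Complex.exp (-θ * Complex.I))
    rw [h1, Complex.ofReal_one, one_mul] at h2
    rw [Complex.ofReal_add, add_mul, Complex.exp_add, h2, mul_assoc, ← Complex.exp_add]
    simp
  · rw [add_sub_cancel_right]
    exact Complex.abs_arg_le_pi _

/-- Radial projection moves `z` by `1 - ‖z‖ < r`, so the projected point is at chordal distance at
most `2 * r` from the midpoint. The chord-to-arc constant `π / 2` turns this into exactly the
half-width `π * r` of the arc. The origin must be excluded because no tent contains it. -/
lemma mem_tent_of_norm_sub_lt {θ r : ℝ} (hr : r ≤ 1) {z : ℂ} (hz0 : z ≠ 0) (hz1 : ‖z‖ < 1)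
    (hz : ‖z - Complex.exp (θ * Complex.I)‖ < r) : z ∈ tent θ r := by
  have h1 : 1 - r < ‖z‖ := by
    have := norm_sub_norm_le (Complex.exp (θ * Complex.I)) z
    rw [norm_sub_rev, Complex.norm_exp_ofReal_mul_I] at this
    linarith
  obtain ⟨x, hx, hxθ⟩ := exists_exp_eq_abs_sub_le (norm_div_norm hz0) θ
  have h2 := abs_sub_le_norm_exp_sub_exp hxθ
  have h3 : ‖z / (‖z‖ : ℂ) - Complex.exp (θ * Complex.I)‖ ≤ 2 * r := by
    have := norm_sub_le_norm_sub_add_norm_sub (z / (‖z‖ : ℂ)) z (Complex.exp (θ * Complex.I))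
    rw [norm_sub_rev (z / (‖z‖ : ℂ)) z, norm_sub_div_norm hz0 hz1.le] at this
    linarith
  rw [hx] at h2
  have h4 : |x - θ| ≤ Real.pi * r := h2.trans (by nlinarith [Real.pi_pos])
  rw [abs_le] at h4
  exact ⟨h1, hz1, x, ⟨by linarith [h4.1], by linarith [h4.2]⟩, hx⟩

lemma mem_tent_one {θ : ℝ} {z : ℂ} (hz0 : z ≠ 0) (hz1 : ‖z‖ < 1) : z ∈ tent θ 1 := by
  obtain ⟨x, hx, hxθ⟩ := exists_exp_eq_abs_sub_le (norm_div_norm hz0) θ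
  rw [abs_le] at hxθ
  exact ⟨by simpa using hz0, hz1, x, ⟨by linarith [hxθ.1], by linarith [hxθ.2]⟩, hx⟩

lemma isClosed_arc (θ h : ℝ) : IsClosed (arc θ h) :=
  (isCompact_Icc.image (by fun_prop)).isClosed

lemma measurableSet_tent (θ h : ℝ) : MeasurableSet (tent θ h) := by
  refine (measurableSet_lt measurable_const measurable_norm).inter
    ((measurableSet_lt measurable_norm measurable_const).inter ?_)
  have hm : Measurable fun z : ℂ => z / (‖z‖ : ℂ) := by fun_prop
  exact hm (isClosed_arc θ h).measurableSet

lemma measure_tent_le (σ : ℝ) (μ : Measure ℂ) (θ : ℝ) {h : ℝ} (hh0 : 0 < h) (hh : h ≤ 1) :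
    μ (tent θ h) ≤ carlesonNorm σ μ * ENNReal.ofReal (h ^ σ) := by
  have h1 : μ (tent θ h) / ENNReal.ofReal (h ^ σ) ≤ carlesonNorm σ μ :=
    le_iSup_of_le θ (le_iSup₂_of_le (f := fun h (_ : h ∈ Ioc (0 : ℝ) 1) =>
      μ (tent θ h) / ENNReal.ofReal (h ^ σ)) h ⟨hh0, hh⟩ le_rfl)
  rwa [ENNReal.div_le_iff (by simpa using Real.rpow_pos_of_pos hh0 σ) ENNReal.ofReal_ne_top] at h1

lemma norm_sub_exp_arg {w : ℂ} (hw : ‖w‖ ≤ 1) :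
    ‖w - Complex.exp (w.arg * Complex.I)‖ = 1 - ‖w‖ := by
  have h : w - Complex.exp (w.arg * Complex.I) =
      ((‖w‖ - 1 : ℝ) : ℂ) * Complex.exp (w.arg * Complex.I) := by
    conv_lhs => rw [← Complex.norm_mul_exp_arg_mul_I w]
    simp [sub_mul]
  rw [h, norm_mul, Complex.norm_exp_ofReal_mul_I, mul_one, Complex.norm_real, Real.norm_eq_abs,
    abs_of_nonpos (by linarith)]
  ring

/-- A Carleson measure of a ball that reaches the unit circle. -/
lemma measure_ball_le {σ : ℝ} (hσ : 0 ≤ σ) (μ : Measure ℂ) {w : ℂ} (hw : ‖w‖ < 1) {r : ℝ}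
    (hr : 1 - ‖w‖ ≤ r) :
    μ {z : ℂ | z ≠ 0 ∧ ‖z‖ < 1 ∧ ‖z - w‖ < r} ≤
      carlesonNorm σ μ * ENNReal.ofReal ((2 * r) ^ σ) := by
  have hr0 : 0 < r := by linarith
  -- The boundary point nearest to `w` is within `r`, so the ball lies within `2 * r` of it. If `2 *
  -- r` exceeds `1`, the tent of size `1`, which is the whole punctured disc, is used instead.
  rcases le_total (2 * r) 1 with h1 | h1
  · refine (measure_mono fun z hz => ?_).trans
      (measure_tent_le σ μ w.arg (by linarith : 0 < 2 * r) h1)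
    refine mem_tent_of_norm_sub_lt h1 hz.1 hz.2.1 ?_
    have := norm_sub_le_norm_sub_add_norm_sub z w (Complex.exp (w.arg * Complex.I))
    rw [norm_sub_exp_arg hw.le] at this
    linarith [hz.2.2]
  · refine (measure_mono fun z hz => mem_tent_one hz.1 hz.2.1).trans
      ((measure_tent_le σ μ 0 one_pos le_rfl).trans ?_)
    gcongr

/-! ### Polar coordinates and the sub-mean value property -/

/-- Polar coordinates on a disc. -/
lemma lintegral_ball_eq_polar {F : ℂ → ℝ≥0∞} (hF : Measurable F) (z : ℂ) (r : ℝ) :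
    ∫⁻ w in ball z r, F w = ∫⁻ ρ in Ioo 0 r, ENNReal.ofReal ρ *
      ∫⁻ θ in Ioo (-Real.pi) Real.pi, F (z + ρ * Complex.exp (θ * Complex.I)) := by
  have h1 : ∫⁻ w in ball z r, F w = ∫⁻ w, (ball z r).indicator F (z + w) := by
    rw [lintegral_add_left_eq_self, lintegral_indicator measurableSet_ball]
  have h2 : ∀ q : ℝ × ℝ, Complex.polarCoord.symm q = q.1 * Complex.exp (q.2 * Complex.I) := by
    intro q
    rw [Complex.polarCoord_symm_apply, Complex.exp_mul_I, Complex.ofReal_cos, Complex.ofReal_sin]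
  rw [h1, ← Complex.lintegral_comp_polarCoord_symm, polarCoord_target, Measure.volume_eq_prod,
    ← Measure.prod_restrict, lintegral_prod]
  · rw [show Ioo 0 r = Iio r ∩ Ioi 0 by rw [inter_comm, Ioi_inter_Iio],
      ← Measure.restrict_restrict measurableSet_Iio, ← lintegral_indicator measurableSet_Iio]
    refine setLIntegral_congr_fun measurableSet_Ioi fun ρ hρ => ?_
    have hρ' : (0 : ℝ) < ρ := hρ
    simp only [h2, smul_eq_mul]
    rw [lintegral_const_mul' _ _ ENNReal.ofReal_ne_top]
    by_cases hr : ρ < r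
    · rw [indicator_of_mem (by exact hr)]
      congr 1
      refine lintegral_congr fun θ => ?_
      rw [indicator_of_mem]
      rw [mem_ball, dist_eq_norm, add_sub_cancel_left, norm_mul, Complex.norm_exp_ofReal_mul_I,
        Complex.norm_real, Real.norm_eq_abs, abs_of_pos hρ', mul_one]
      exact hr
    · rw [indicator_of_notMem (by exact hr)]
      have : ∀ θ : ℝ, (ball z r).indicator F (z + ρ * Complex.exp (θ * Complex.I)) = 0 := by
        intro θ
        refine indicator_of_notMem ?_ _
        rw [mem_ball, dist_eq_norm, add_sub_cancel_left, norm_mul, Complex.norm_exp_ofReal_mul_I,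
          Complex.norm_real, Real.norm_eq_abs, abs_of_pos hρ', mul_one]
        exact hr
      simp [this]
  · simp only [h2]
    refine Measurable.aemeasurable ?_
    have : Measurable ((ball z r).indicator F) := hF.indicator measurableSet_ball
    fun_prop

lemma two_pi_mul_enorm_le_lintegral_circle {g : ℂ → ℂ} {z : ℂ} {r ρ : ℝ} (hρ : 0 < ρ) (hr : ρ < r)
    (hg : DifferentiableOn ℂ g (ball z r)) :
    ENNReal.ofReal (2 * Real.pi) * ‖g z‖ₑ ≤
      ∫⁻ θ in Ioo (-Real.pi) Real.pi, ‖g (z + ρ * Complex.exp (θ * Complex.I))‖ₑ := by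
  have hd : DiffContOnCl ℂ g (ball z |ρ|) := by
    rw [abs_of_pos hρ]
    refine DifferentiableOn.diffContOnCl (hg.mono ?_)
    exact closure_ball_subset_closedBall.trans (closedBall_subset_ball hr)
  have h1 := hd.circleAverage
  have hpi := Real.pi_pos
  rw [Real.circleAverage_eq_integral_add (-Real.pi),
    intervalIntegral.integral_comp_add_right (fun x => g (circleMap z ρ x)) (-Real.pi), zero_add,
    show 2 * Real.pi + -Real.pi = Real.pi by ring,
    intervalIntegral.integral_of_le (by linarith), inv_smul_eq_iff₀ (by positivity)] at h1
  calc ENNReal.ofReal (2 * Real.pi) * ‖g z‖ₑ = ‖(2 * Real.pi) • g z‖ₑ := by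
        rw [enorm_smul, Real.enorm_eq_ofReal (by positivity)]
    _ ≤ ∫⁻ θ in Ioc (-Real.pi) Real.pi, ‖g (circleMap z ρ θ)‖ₑ := by
        rw [← h1]; exact enorm_integral_le_lintegral_enorm _
    _ = _ := by rw [setLIntegral_congr Ioo_ae_eq_Ioc.symm]; rfl

/-- The case of exponent one comes from averaging the mean value property over circles. Hölder's
inequality against the constant `1` then raises it to the power `p`. -/
lemma enorm_rpow_mul_le_lintegral_ball {g : ℂ → ℂ} (hgm : Measurable g) {z : ℂ} {r p : ℝ}
    (hr : 0 < r) (hp : 1 < p) (hg : DifferentiableOn ℂ g (ball z r)) :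
    ‖g z‖ₑ ^ p * volume (ball z r) ≤ ∫⁻ w in ball z r, ‖g w‖ₑ ^ p := by
  have h1 : ‖g z‖ₑ * volume (ball z r) ≤ ∫⁻ w in ball z r, ‖g w‖ₑ := by
    rw [← setLIntegral_const, lintegral_ball_eq_polar measurable_const,
      lintegral_ball_eq_polar hgm.enorm]
    refine setLIntegral_mono' measurableSet_Ioo fun ρ hρ => ?_
    gcongr 1
    refine le_trans (le_of_eq ?_) (two_pi_mul_enorm_le_lintegral_circle hρ.1 hρ.2 hg)
    rw [setLIntegral_const, Real.volume_Ioo, mul_comm]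
    congr 2
    ring
  have hv0 : volume (ball z r) ≠ 0 := (measure_ball_pos _ _ hr).ne'
  have hvt : volume (ball z r) ≠ ∞ := measure_ball_lt_top.ne
  have hq := Real.HolderConjugate.conjExponent hp
  have h2 := ENNReal.lintegral_mul_le_Lp_mul_Lq (volume.restrict (ball z r)) hq
    (f := fun w => ‖g w‖ₑ) (g := fun _ => 1) hgm.enorm.aemeasurable aemeasurable_const
  simp only [Pi.mul_apply, mul_one, ENNReal.one_rpow, lintegral_const, one_mul,
    Measure.restrict_apply_univ] at h2
  have h3 := ENNReal.rpow_le_rpow (h1.trans h2) (zero_le_one.trans hp.le)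
  rw [ENNReal.mul_rpow_of_nonneg _ _ (by linarith), ENNReal.mul_rpow_of_nonneg _ _ (by linarith),
    ← ENNReal.rpow_mul, ← ENNReal.rpow_mul, one_div_mul_cancel (by linarith), ENNReal.rpow_one] at h3
  -- Since `p = 1 + p / p'` for the conjugate exponent `p'`, the Hölder factor cancels and one power
  -- of the volume survives.
  have h4 : volume (ball z r) ^ p =
      volume (ball z r) * volume (ball z r) ^ (1 / p.conjExponent * p) := by
    conv_rhs => enter [1]; rw [← ENNReal.rpow_one (volume (ball z r))]
    rw [← ENNReal.rpow_add _ _ hv0 hvt]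
    congr 1
    have := hq.inv_add_inv_eq_one
    have hp0 : p ≠ 0 := by linarith
    rw [one_div, ← sub_eq_iff_eq_add'.2 this.symm, sub_mul, inv_mul_cancel₀ hp0]
    ring
  rw [h4, ← mul_assoc] at h3
  refine (ENNReal.mul_le_mul_iff_left ?_ ?_).1 h3
  · exact (ENNReal.rpow_pos (pos_iff_ne_zero.2 hv0) hvt).ne'
  · exact (ENNReal.rpow_lt_top_of_nonneg (by have := hq.symm.pos; positivity) hvt).ne

/-! ### Möbius factors and the mass of `|f'|^p` near an arc -/

/-- Comparable quantities have comparable powers. The exponent `|q|` on the constant covers both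
signs, as weights such as `p - 3 - ε` may be negative. -/
lemma rpow_le_rpow_abs_mul_rpow {x y A : ℝ} (hx : 0 < x) (hy : 0 < y) (hA : 1 ≤ A)
    (hxy : x ≤ A * y) (hyx : y ≤ A * x) (q : ℝ) : x ^ q ≤ A ^ |q| * y ^ q := by
  have hA0 : 0 < A := by linarith
  rcases le_total 0 q with hq | hq
  · rw [abs_of_nonneg hq, ← Real.mul_rpow hA0.le hy.le]
    exact Real.rpow_le_rpow hx.le hxy hq
  · have h1 : y / A ≤ x := by rw [div_le_iff₀ hA0]; linarith
    refine (Real.rpow_le_rpow_of_nonpos (by positivity) h1 hq).trans_eq ?_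
    rw [Real.div_rpow hy.le hA0.le, abs_of_nonpos hq, Real.rpow_neg hA0.le]
    field_simp

lemma one_sub_conj_mul_ne_zero {a z : ℂ} (ha : ‖a‖ < 1) (hz : ‖z‖ ≤ 1) :
    1 - (starRingEnd ℂ) a * z ≠ 0 := by
  intro h
  have h1 : ‖(starRingEnd ℂ) a * z‖ = 1 := by rw [← sub_eq_zero.1 h, norm_one]
  rw [norm_mul, RCLike.norm_conj] at h1
  nlinarith [norm_nonneg a, norm_nonneg z]

lemma one_sub_norm_mobius_sq {a z : ℂ} (ha : ‖a‖ < 1) (hz : ‖z‖ < 1) :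
    1 - ‖mobius a z‖ ^ 2 =
      (1 - ‖a‖ ^ 2) * (1 - ‖z‖ ^ 2) / ‖1 - (starRingEnd ℂ) a * z‖ ^ 2 := by
  have h0 := one_sub_conj_mul_ne_zero ha hz.le
  have h1 : ‖1 - (starRingEnd ℂ) a * z‖ ^ 2 ≠ 0 := pow_ne_zero _ (norm_ne_zero_iff.2 h0)
  rw [mobius, norm_div, div_pow, eq_div_iff h1, sub_mul, div_mul_cancel₀ _ h1]
  simp only [← Complex.normSq_eq_norm_sq, Complex.normSq_apply, Complex.sub_re, Complex.sub_im,
    Complex.mul_re, Complex.mul_im, Complex.one_re, Complex.one_im, Complex.conj_re,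
    Complex.conj_im]
  ring

lemma norm_one_sub_conj_mul (x θ : ℝ) (w : ℂ) :
    ‖1 - (starRingEnd ℂ) (x * Complex.exp (θ * Complex.I)) * w‖ =
      ‖Complex.exp (θ * Complex.I) - x * w‖ := by
  have h : Complex.exp (θ * Complex.I) * (starRingEnd ℂ) (Complex.exp (θ * Complex.I)) = 1 := by
    rw [Complex.mul_conj, Complex.normSq_eq_norm_sq, Complex.norm_exp_ofReal_mul_I]
    simp
  rw [← one_mul ‖1 - _‖, ← Complex.norm_exp_ofReal_mul_I θ, ← norm_mul, mul_sub, map_mul,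
    Complex.conj_ofReal]
  congr 1
  linear_combination (-(x * w) : ℂ) * h

/-- The point of the disc at distance `h / 2` from `exp (i θ)`. -/
def center (θ h : ℝ) : ℂ := ((1 - h / 2 : ℝ) : ℂ) * Complex.exp (θ * Complex.I)

lemma norm_center (θ : ℝ) {h : ℝ} (h1 : h ≤ 1) : ‖center θ h‖ = 1 - h / 2 := by
  rw [center, norm_mul, Complex.norm_exp_ofReal_mul_I, mul_one, Complex.norm_real,
    Real.norm_eq_abs, abs_of_nonneg (by linarith)]

lemma norm_one_sub_conj_center_mul_le (θ : ℝ) {h : ℝ} (h0 : 0 < h) {w : ℂ}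
    (hw : ‖w‖ ≤ 1) :
    ‖1 - (starRingEnd ℂ) (center θ h) * w‖ ≤ ‖w - Complex.exp (θ * Complex.I)‖ + h := by
  rw [center, norm_one_sub_conj_mul]
  have h2 : Complex.exp (θ * Complex.I) - ((1 - h / 2 : ℝ) : ℂ) * w =
      -(w - Complex.exp (θ * Complex.I)) + ((h / 2 : ℝ) : ℂ) * w := by
    push_cast; ring
  rw [h2]
  refine (norm_add_le _ _).trans ?_
  rw [norm_neg, norm_mul, Complex.norm_real, Real.norm_eq_abs, abs_of_pos (by linarith)]
  nlinarith [norm_nonneg w]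

lemma lintegral_deriv_le_fNorm_rpow {p : ℝ} (hp : 0 < p) (q t : ℝ) (f : ℂ → ℂ) {a : ℂ}
    (ha : ‖a‖ < 1) :
    ∫⁻ z in disc, ENNReal.ofReal
      (‖deriv f z‖ ^ p * (1 - ‖z‖ ^ 2) ^ q * (1 - ‖mobius a z‖ ^ 2) ^ t) ≤ fNorm p q t f ^ p := by
  have h1 : (∫⁻ z in disc, ENNReal.ofReal
      (‖deriv f z‖ ^ p * (1 - ‖z‖ ^ 2) ^ q * (1 - ‖mobius a z‖ ^ 2) ^ t)) ^ (1 / p) ≤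
      fNorm p q t f := by
    refine le_trans ?_ le_add_self
    exact le_iSup₂_of_le (f := fun a (_ : a ∈ disc) => (∫⁻ z in disc, ENNReal.ofReal
      (‖deriv f z‖ ^ p * (1 - ‖z‖ ^ 2) ^ q * (1 - ‖mobius a z‖ ^ 2) ^ t)) ^ (1 / p)) a
      (mem_ball_zero_iff.2 ha) le_rfl
  have h2 := ENNReal.rpow_le_rpow h1 hp.le
  rwa [← ENNReal.rpow_mul, one_div_mul_cancel hp.ne', ENNReal.rpow_one] at h2

lemma measurableSet_cap (u : ℂ) (r : ℝ) : MeasurableSet {w : ℂ | ‖w‖ < 1 ∧ ‖w - u‖ < r} :=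
  (measurableSet_lt measurable_norm measurable_const).inter
    (measurableSet_lt (measurable_id.sub_const u).norm measurable_const)

/-- For `f` in `F(p, q, t)`, the measure `|f'|^p (1 - |w|)^(q + t) dA` is `t`-Carleson. -/
lemma lintegral_cap_le_fNorm {p q t : ℝ} (hp : 0 < p) (ht : 0 < t) (f : ℂ → ℂ) (θ : ℝ) {h : ℝ}
    (h0 : 0 < h) (h1 : h ≤ 1) :
    ∫⁻ w in {w : ℂ | ‖w‖ < 1 ∧ ‖w - Complex.exp (θ * Complex.I)‖ < 6 * h},
      ‖deriv f w‖ₑ ^ p * ENNReal.ofReal ((1 - ‖w‖) ^ (q + t)) ≤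
    ENNReal.ofReal (2 ^ |q + t| * 98 ^ t) * ENNReal.ofReal (h ^ t) * fNorm p q t f ^ p := by
  have ha : ‖center θ h‖ < 1 := by rw [norm_center θ h1]; linarith
  calc _ ≤ ∫⁻ w in {w : ℂ | ‖w‖ < 1 ∧ ‖w - Complex.exp (θ * Complex.I)‖ < 6 * h},
        ENNReal.ofReal (2 ^ |q + t| * 98 ^ t * h ^ t) * ENNReal.ofReal (‖deriv f w‖ ^ p *
          (1 - ‖w‖ ^ 2) ^ q * (1 - ‖mobius (center θ h) w‖ ^ 2) ^ t) := by
        refine setLIntegral_mono' (measurableSet_cap _ _) fun w hw => ?_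
        have hw1 := hw.1
        have hn := norm_nonneg w
        have hb : 0 < 1 - ‖w‖ ^ 2 := by nlinarith
        rw [← ofReal_norm, ENNReal.ofReal_rpow_of_nonneg (norm_nonneg _) hp.le,
          ← ENNReal.ofReal_mul (by positivity), ← ENNReal.ofReal_mul (by positivity)]
        apply ENNReal.ofReal_le_ofReal
        have e1 : (1 - ‖w‖) ^ (q + t) ≤ 2 ^ |q + t| * (1 - ‖w‖ ^ 2) ^ (q + t) :=
          rpow_le_rpow_abs_mul_rpow (by linarith) hb one_le_two (by nlinarith) (by nlinarith) _
        -- With `b = center θ h`, one has `1 - ‖b‖ ^ 2 ≥ h / 2`, and the denominator `‖1 - conj b *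
        -- w‖` is at most `6 * h + h`. Hence `98 = 2 * 7 ^ 2`.
        have e2 : (1 - ‖w‖ ^ 2) / (98 * h) ≤ 1 - ‖mobius (center θ h) w‖ ^ 2 := by
          rw [one_sub_norm_mobius_sq ha hw1]
          have hd := norm_one_sub_conj_center_mul_le θ h0 hw1.le
          have hd0 : 0 < ‖1 - (starRingEnd ℂ) (center θ h) * w‖ :=
            norm_pos_iff.2 (one_sub_conj_mul_ne_zero ha hw1.le)
          have hd1 : ‖1 - (starRingEnd ℂ) (center θ h) * w‖ ≤ 7 * h := by linarith [hw.2]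
          have hd2 : ‖1 - (starRingEnd ℂ) (center θ h) * w‖ ^ 2 ≤ 49 * h ^ 2 := by nlinarith
          have hc : h / 2 ≤ 1 - ‖center θ h‖ ^ 2 := by rw [norm_center θ h1]; nlinarith
          rw [div_le_div_iff₀ (by positivity) (by positivity)]
          calc (1 - ‖w‖ ^ 2) * ‖1 - (starRingEnd ℂ) (center θ h) * w‖ ^ 2
              ≤ (1 - ‖w‖ ^ 2) * (49 * h ^ 2) := by gcongr
            _ = h / 2 * (1 - ‖w‖ ^ 2) * (98 * h) := by ring
            _ ≤ _ := by gcongr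
        have e3 : (1 - ‖w‖ ^ 2) ^ t ≤
            98 ^ t * h ^ t * (1 - ‖mobius (center θ h) w‖ ^ 2) ^ t := by
          rw [← Real.mul_rpow (by norm_num) h0.le, ← Real.mul_rpow (by positivity)
            (le_trans (by positivity) e2)]
          refine Real.rpow_le_rpow hb.le ?_ ht.le
          rw [div_le_iff₀ (by positivity)] at e2
          linarith
        calc ‖deriv f w‖ ^ p * (1 - ‖w‖) ^ (q + t)
            ≤ ‖deriv f w‖ ^ p * (2 ^ |q + t| * ((1 - ‖w‖ ^ 2) ^ q *
              (98 ^ t * h ^ t * (1 - ‖mobius (center θ h) w‖ ^ 2) ^ t))) := by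
              rw [Real.rpow_add hb] at e1
              refine mul_le_mul_of_nonneg_left (e1.trans ?_) (by positivity)
              gcongr
          _ = _ := by ring
    _ = ENNReal.ofReal (2 ^ |q + t| * 98 ^ t * h ^ t) *
        ∫⁻ w in {w : ℂ | ‖w‖ < 1 ∧ ‖w - Complex.exp (θ * Complex.I)‖ < 6 * h},
          ENNReal.ofReal (‖deriv f w‖ ^ p *
          (1 - ‖w‖ ^ 2) ^ q * (1 - ‖mobius (center θ h) w‖ ^ 2) ^ t) :=
        lintegral_const_mul' _ _ ENNReal.ofReal_ne_top
    _ ≤ _ := by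
        rw [ENNReal.ofReal_mul (by positivity)]
        refine mul_le_mul_right ((lintegral_mono_set fun w hw => mem_ball_zero_iff.2 hw.1).trans
          (lintegral_deriv_le_fNorm_rpow hp q t f ha)) _

/-! ### Pointwise growth of `f'` and `f` -/

lemma enorm_deriv_rpow_mul_le {f : ℂ → ℂ} (hf : DifferentiableOn ℂ f disc) {p : ℝ} (hp : 1 < p)
    {z : ℂ} (hz : ‖z‖ < 1) :
    ‖deriv f z‖ₑ ^ p * ENNReal.ofReal ((1 - ‖z‖) ^ (2 : ℝ)) ≤
      2 * ∫⁻ w in ball z ((1 - ‖z‖) / 2), ‖deriv f w‖ₑ ^ p := by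
  have hsub : ball z ((1 - ‖z‖) / 2) ⊆ disc := by
    refine (ball_subset_ball' ?_).trans (Subset.refl (ball (0 : ℂ) 1))
    rw [dist_zero_right]; linarith
  have h1 := enorm_rpow_mul_le_lintegral_ball (measurable_deriv f) (z := z)
    (r := (1 - ‖z‖) / 2) (by linarith) hp ((hf.deriv isOpen_ball).mono hsub)
  refine le_trans ?_ (mul_le_mul_right h1 2)
  rw [mul_left_comm]
  refine mul_le_mul_right ?_ _
  rw [Complex.volume_ball, ← ENNReal.ofReal_pow (by linarith), ← ENNReal.ofReal_coe_nnreal,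
    ← ENNReal.ofReal_mul (by positivity), show (2 : ℝ≥0∞) = ENNReal.ofReal 2 by simp,
    ← ENNReal.ofReal_mul (by norm_num)]
  apply ENNReal.ofReal_le_ofReal
  rw [Real.rpow_two, NNReal.coe_real_pi]
  nlinarith [Real.pi_gt_three, sq_nonneg (1 - ‖z‖)]

lemma enorm_apply_zero_le_fNorm (p q t : ℝ) (f : ℂ → ℂ) : ‖f 0‖ₑ ≤ fNorm p q t f := le_self_add

/-- The disc about `z` of radius `δ / 2`, `δ = 1 - ‖z‖`, lies in the cap of size `δ` at the nearest
boundary point, and `1 - ‖w‖` is comparable to `δ` on it. The sub-mean value property and the cap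
estimate give `‖f'(z)‖ ^ p δ ^ (pα + t) ≲ δ ^ t N ^ p`. -/
lemma exists_norm_deriv_le {α t p : ℝ} (ht : 0 < t) (hp : 1 < p) :
    ∃ K : ℝ, 0 ≤ K ∧ ∀ f ∈ fSpace p (p * α - 2) t, ∀ z : ℂ, ‖z‖ < 1 →
      ‖deriv f z‖ ≤ K * (fNorm p (p * α - 2) t f).toReal * (1 - ‖z‖) ^ (-α) := by
  set e := p * α - 2 + t with he
  set C : ℝ := 2 * 2 ^ |e| * (2 ^ |e| * 98 ^ t) with hC
  have hC0 : 0 ≤ C := by positivity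
  refine ⟨C ^ (1 / p), by positivity, fun f hf z hz => ?_⟩
  have hp0 : 0 < p := by linarith
  have hδ : 0 < 1 - ‖z‖ := by linarith
  have hn := norm_nonneg z
  set N := fNorm p (p * α - 2) t f with hN
  have hsub : ball z ((1 - ‖z‖) / 2) ⊆
      {w : ℂ | ‖w‖ < 1 ∧ ‖w - Complex.exp (z.arg * Complex.I)‖ < 6 * (1 - ‖z‖)} := by
    intro w hw
    rw [mem_ball, dist_eq_norm] at hw
    have h1 := norm_sub_le_norm_sub_add_norm_sub w z (Complex.exp (z.arg * Complex.I))
    rw [norm_sub_exp_arg hz.le] at h1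
    have h2 := norm_sub_norm_le w z
    exact ⟨by linarith, by linarith⟩
  have h1 : ENNReal.ofReal ((1 - ‖z‖) ^ e) * ∫⁻ w in ball z ((1 - ‖z‖) / 2), ‖deriv f w‖ₑ ^ p ≤
      ENNReal.ofReal (2 ^ |e|) * (ENNReal.ofReal (2 ^ |e| * 98 ^ t) *
        ENNReal.ofReal ((1 - ‖z‖) ^ t) * N ^ p) := by
    rw [← lintegral_const_mul' _ _ ENNReal.ofReal_ne_top]
    refine le_trans ?_ (mul_le_mul_right (lintegral_cap_le_fNorm hp0 ht f z.arg hδ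
      (by linarith : 1 - ‖z‖ ≤ 1)) _)
    rw [← lintegral_const_mul' _ _ ENNReal.ofReal_ne_top]
    refine le_trans (setLIntegral_mono' measurableSet_ball fun w hw => ?_)
      (lintegral_mono_set hsub)
    rw [mul_left_comm, mul_comm]
    refine mul_le_mul_right ?_ _
    rw [← ENNReal.ofReal_mul (by positivity)]
    apply ENNReal.ofReal_le_ofReal
    rw [mem_ball, dist_eq_norm] at hw
    have h2 := norm_sub_norm_le w z
    have h3 := norm_sub_norm_le z w
    rw [norm_sub_rev] at h3
    exact rpow_le_rpow_abs_mul_rpow hδ (by linarith) one_le_two (by linarith) (by linarith) _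
  have h2 := enorm_deriv_rpow_mul_le hf.1 hp hz
  have h3 : ENNReal.ofReal (‖deriv f z‖ ^ p * (1 - ‖z‖) ^ (2 : ℝ) * (1 - ‖z‖) ^ e) ≤
      ENNReal.ofReal (C * (1 - ‖z‖) ^ t * N.toReal ^ p) := by
    rw [ENNReal.ofReal_mul (by positivity), ENNReal.ofReal_mul (by positivity),
      ENNReal.ofReal_mul (by positivity), ENNReal.ofReal_mul (by positivity),
      ← ENNReal.ofReal_rpow_of_nonneg (norm_nonneg _) hp0.le, ofReal_norm,
      ← ENNReal.ofReal_rpow_of_nonneg ENNReal.toReal_nonneg hp0.le, ENNReal.ofReal_toReal hf.2.ne]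
    calc _ ≤ (2 * ∫⁻ w in ball z ((1 - ‖z‖) / 2), ‖deriv f w‖ₑ ^ p) *
          ENNReal.ofReal ((1 - ‖z‖) ^ e) := mul_le_mul_left h2 _
      _ = 2 * (ENNReal.ofReal ((1 - ‖z‖) ^ e) *
          ∫⁻ w in ball z ((1 - ‖z‖) / 2), ‖deriv f w‖ₑ ^ p) := by ring
      _ ≤ 2 * _ := mul_le_mul_right h1 _
      _ = _ := by
        rw [hC, ENNReal.ofReal_mul (p := 2 * 2 ^ |e|) (by positivity),
          ENNReal.ofReal_mul (p := 2) (by norm_num), ENNReal.ofReal_ofNat, ← hN]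
        ring
  rw [ENNReal.ofReal_le_ofReal_iff (by positivity)] at h3
  have h4 : ‖deriv f z‖ ^ p ≤ (C ^ (1 / p) * N.toReal * (1 - ‖z‖) ^ (-α)) ^ p := by
    rw [Real.mul_rpow (by positivity) (by positivity), Real.mul_rpow (by positivity)
      (by positivity), ← Real.rpow_mul hC0, one_div_mul_cancel hp0.ne', Real.rpow_one,
      ← Real.rpow_mul hδ.le]
    have h5 : 0 < (1 - ‖z‖) ^ (p * α + t) := Real.rpow_pos_of_pos hδ _
    refine le_of_mul_le_mul_right ?_ h5
    calc ‖deriv f z‖ ^ p * (1 - ‖z‖) ^ (p * α + t)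
        = ‖deriv f z‖ ^ p * (1 - ‖z‖) ^ (2 : ℝ) * (1 - ‖z‖) ^ e := by
          rw [mul_assoc, ← Real.rpow_add hδ, he]; congr 2; ring
      _ ≤ _ := h3
      _ = C * N.toReal ^ p * ((1 - ‖z‖) ^ (-α * p) * (1 - ‖z‖) ^ (p * α + t)) := by
          rw [← Real.rpow_add hδ, show -α * p + (p * α + t) = t by ring]; ring
      _ = _ := by ring
  exact (Real.rpow_le_rpow_iff (norm_nonneg _) (by positivity) hp0).1 h4

lemma hasDerivAt_radial {f : ℂ → ℂ} (hf : DifferentiableOn ℂ f disc) {ζ : ℂ} (hζ : ‖ζ‖ = 1) {x : ℝ}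
    (hx : |x| < 1) : HasDerivAt (fun ρ : ℝ => f (ρ * ζ)) (deriv f (x * ζ) * ζ) x := by
  have h1 : (x * ζ : ℂ) ∈ disc := by
    rw [disc, mem_ball_zero_iff, norm_mul, hζ, mul_one, Complex.norm_real]
    exact hx
  have h2 : HasDerivAt f (deriv f (x * ζ)) (x * ζ) :=
    (hf.differentiableAt (isOpen_ball.mem_nhds h1)).hasDerivAt
  have h3 : HasDerivAt (fun ρ : ℂ => f (ρ * ζ)) (deriv f (x * ζ) * ζ) (x : ℂ) := by
    have : HasDerivAt (fun ρ : ℂ => f (ρ * ζ)) (deriv f (x * ζ) * (1 * ζ)) (x : ℂ) :=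
      HasDerivAt.comp (x : ℂ) h2 ((hasDerivAt_id (x : ℂ)).mul_const ζ)
    rwa [one_mul] at this
  exact h3.comp_ofReal

/-- The derivative bound is integrated along the radius from `0`. As `α > 1`, the primitive `(1 - r)
^ (1 - α) / (α - 1)` also dominates constants, which absorbs `‖f 0‖ ≤ N`. -/
lemma exists_norm_le_growth {α t p : ℝ} (hα : 1 < α) (ht : 0 < t) (hp : 1 < p) :
    ∃ K : ℝ, 0 ≤ K ∧ ∀ f ∈ fSpace p (p * α - 2) t, ∀ ζ : ℂ, ‖ζ‖ = 1 → ∀ r : ℝ, 0 ≤ r → r < 1 →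
      ‖f (r * ζ)‖ ≤ K * (fNorm p (p * α - 2) t f).toReal * (1 - r) ^ (1 - α) := by
  obtain ⟨K, hK, h⟩ := exists_norm_deriv_le (α := α) ht hp
  refine ⟨K / (α - 1) + 1, by have : 0 < α - 1 := by linarith
                              positivity, fun f hf ζ hζ r hr0 hr1 => ?_⟩
  have hα' : 0 < α - 1 := by linarith
  set N := (fNorm p (p * α - 2) t f).toReal with hN
  have hN0 : 0 ≤ N := ENNReal.toReal_nonneg
  have hf0 : ‖f 0‖ ≤ N := by
    have := ENNReal.toReal_mono hf.2.ne (enorm_apply_zero_le_fNorm p (p * α - 2) t f)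
    simpa using this
  have hd : ∀ x ∈ Icc 0 r, HasDerivAt (fun ρ : ℝ => f (ρ * ζ)) (deriv f (x * ζ) * ζ) x :=
    fun x hx => hasDerivAt_radial hf.1 hζ (by rw [abs_of_nonneg hx.1]; linarith [hx.2])
  have hB : ∀ x ∈ Icc 0 r, HasDerivAt (fun ρ : ℝ => N + K * N / (α - 1) * (1 - ρ) ^ (1 - α))
      (K * N * (1 - x) ^ (-α)) x := by
    intro x hx
    have h1 : HasDerivAt (fun ρ : ℝ => 1 - ρ) (-1) x := by
      simpa using (hasDerivAt_id x).const_sub 1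
    have h2 := ((h1.rpow_const (p := 1 - α) (Or.inl (by linarith [hx.2]))).const_mul
      (K * N / (α - 1))).const_add N
    refine h2.congr_deriv ?_
    rw [show 1 - α - 1 = -α by ring]
    field_simp
    ring
  have h1 := image_norm_le_of_norm_deriv_right_le_deriv_boundary'
    (f := fun ρ : ℝ => f (ρ * ζ)) (a := 0) (b := r)
    (fun x hx => (hd x hx).continuousAt.continuousWithinAt)
    (fun x hx => (hd x (Ico_subset_Icc_self hx)).hasDerivWithinAt)
    (B := fun ρ : ℝ => N + K * N / (α - 1) * (1 - ρ) ^ (1 - α))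
    (by simp only [Complex.ofReal_zero, zero_mul, sub_zero, Real.one_rpow, mul_one]
        have : 0 ≤ K * N / (α - 1) := by positivity
        linarith)
    (fun x hx => (hB x hx).continuousAt.continuousWithinAt)
    (fun x hx => (hB x (Ico_subset_Icc_self hx)).hasDerivWithinAt)
    (by
      intro x hx
      rw [norm_mul, hζ, mul_one]
      have hxn : ‖(x * ζ : ℂ)‖ = x := by
        rw [norm_mul, hζ, mul_one, Complex.norm_real, Real.norm_eq_abs, abs_of_nonneg hx.1]
      have := h f hf (x * ζ) (by rw [hxn]; linarith [hx.2])
      rwa [hxn] at this)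
    (right_mem_Icc.2 hr0)
  refine h1.trans ?_
  have h2 : 1 ≤ (1 - r) ^ (1 - α) :=
    Real.one_le_rpow_of_pos_of_le_one_of_nonpos (by linarith) (by linarith) (by linarith)
  calc N + K * N / (α - 1) * (1 - r) ^ (1 - α)
      ≤ N * (1 - r) ^ (1 - α) + K * N / (α - 1) * (1 - r) ^ (1 - α) := by nlinarith
    _ = _ := by ring

/-! ### Oscillation along radii -/

lemma lintegral_Ioo_rpow {b k : ℝ} (hb : 0 ≤ b) (hk : 0 < k) :
    ∫⁻ x in Ioo 0 b, ENNReal.ofReal (x ^ (k - 1)) = ENNReal.ofReal (b ^ k / k) := by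
  have hi : IntegrableOn (fun x : ℝ => x ^ (k - 1)) (Ioc 0 b) :=
    (intervalIntegrable_iff_integrableOn_Ioc_of_le hb).1
      (intervalIntegral.intervalIntegrable_rpow' (by linarith))
  rw [← ofReal_integral_eq_lintegral_ofReal (hi.mono_set Ioo_subset_Ioc_self),
    ← integral_Ioc_eq_integral_Ioo, ← intervalIntegral.integral_of_le hb,
    integral_rpow (Or.inl (by linarith)), sub_add_cancel, Real.zero_rpow hk.ne', sub_zero]
  filter_upwards [ae_restrict_mem measurableSet_Ioo] with x hx
  exact Real.rpow_nonneg hx.1.le _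

lemma lintegral_Ioo_one_sub_rpow {a k : ℝ} (ha : a ≤ 1) (hk : 0 < k) :
    ∫⁻ x in Ioo a 1, ENNReal.ofReal ((1 - x) ^ (k - 1)) = ENNReal.ofReal ((1 - a) ^ k / k) := by
  rw [← lintegral_Ioo_rpow (by linarith) hk, ← lintegral_indicator measurableSet_Ioo,
    ← lintegral_indicator measurableSet_Ioo,
    ← lintegral_sub_left_eq_self ((Ioo 0 (1 - a)).indicator _) (1 : ℝ)]
  refine lintegral_congr fun x => ?_
  by_cases hx : x ∈ Ioo a 1
  · have hx' : 1 - x ∈ Ioo 0 (1 - a) := ⟨by linarith [hx.2], by linarith [hx.1]⟩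
    rw [indicator_of_mem hx, indicator_of_mem hx']
  · rw [indicator_of_notMem hx, indicator_of_notMem]
    exact fun h => hx ⟨by linarith [h.2], by linarith [h.1]⟩

lemma enorm_radial_sub_le {f : ℂ → ℂ} (hf : DifferentiableOn ℂ f disc) {ζ : ℂ} (hζ : ‖ζ‖ = 1)
    {a r : ℝ} (ha : 0 ≤ a) (har : a ≤ r) (hr : r < 1) :
    ‖f (r * ζ) - f (a * ζ)‖ₑ ≤ ∫⁻ ρ in Ioo a r, ‖deriv f (ρ * ζ)‖ₑ := by
  have hmem : ∀ ρ ∈ uIcc a r, |ρ| < 1 := by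
    intro ρ hρ
    rw [uIcc_of_le har] at hρ
    rw [abs_of_nonneg (ha.trans hρ.1)]
    linarith [hρ.2]
  have hc : ContinuousOn (fun ρ : ℝ => deriv f (ρ * ζ) * ζ) (uIcc a r) := by
    refine ContinuousOn.mul ?_ continuousOn_const
    refine (hf.deriv isOpen_ball).continuousOn.comp (by fun_prop) fun ρ hρ => ?_
    rw [disc, mem_ball_zero_iff, norm_mul, hζ, mul_one, Complex.norm_real]
    exact hmem ρ hρ
  rw [← intervalIntegral.integral_eq_sub_of_hasDerivAt
    (fun ρ hρ => hasDerivAt_radial hf hζ (hmem ρ hρ)) hc.intervalIntegrable,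
    intervalIntegral.integral_of_le har, setLIntegral_congr Ioo_ae_eq_Ioc]
  refine (enorm_integral_le_lintegral_enorm _).trans_eq (lintegral_congr fun ρ => ?_)
  rw [enorm_mul, ← ofReal_norm ζ, hζ, ENNReal.ofReal_one, mul_one]

/-- Hölder's inequality after inserting `(1 - ρ) ^ c` and its inverse, `c = (p - 1 - ε) / p`. The
dual weight has exponent `-1 + ε / (p - 1)`, integrable up to `ρ = 1` exactly because `ε > 0`, and
its integral supplies the gain `(1 - a) ^ ε`. -/
lemma enorm_radial_sub_rpow_le {f : ℂ → ℂ} (hf : DifferentiableOn ℂ f disc) {ζ : ℂ} (hζ : ‖ζ‖ = 1)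
    {a r p ε : ℝ} (ha : 0 ≤ a) (har : a ≤ r) (hr : r < 1) (hp : 1 < p) (hε : 0 < ε) :
    ‖f (r * ζ) - f (a * ζ)‖ₑ ^ p ≤ ENNReal.ofReal (((p - 1) / ε) ^ (p - 1) * (1 - a) ^ ε) *
      ∫⁻ ρ in Ioo a r, ‖deriv f (ρ * ζ)‖ₑ ^ p * ENNReal.ofReal ((1 - ρ) ^ (p - 1 - ε)) := by
  have hp0 : 0 < p := by linarith
  have hp1 : 0 < p - 1 := by linarith
  have hq := Real.HolderConjugate.conjExponent hp
  have hq0 : 0 < p.conjExponent := hq.symm.pos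
  have hqe : p.conjExponent = p / (p - 1) := rfl
  set c : ℝ := (p - 1 - ε) / p with hc
  have hm : Measurable fun ρ : ℝ => ‖deriv f (ρ * ζ)‖ₑ :=
    ((measurable_deriv f).comp (by fun_prop : Measurable fun ρ : ℝ => (ρ : ℂ) * ζ)).enorm
  have h1 := ENNReal.lintegral_mul_le_Lp_mul_Lq (volume.restrict (Ioo a r)) hq
    (f := fun ρ : ℝ => ‖deriv f (ρ * ζ)‖ₑ * ENNReal.ofReal ((1 - ρ) ^ c))
    (g := fun ρ : ℝ => ENNReal.ofReal ((1 - ρ) ^ (-c)))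
    (by fun_prop) (by fun_prop)
  have h2 : ‖f (r * ζ) - f (a * ζ)‖ₑ ≤ ∫⁻ ρ in Ioo a r,
      ((fun ρ : ℝ => ‖deriv f (ρ * ζ)‖ₑ * ENNReal.ofReal ((1 - ρ) ^ c)) *
        fun ρ : ℝ => ENNReal.ofReal ((1 - ρ) ^ (-c))) ρ := by
    refine (enorm_radial_sub_le hf hζ ha har hr).trans_eq ?_
    refine setLIntegral_congr_fun measurableSet_Ioo fun ρ hρ => ?_
    have h0 : 0 < 1 - ρ := by linarith [hρ.2]
    simp only [Pi.mul_apply]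
    rw [mul_assoc, ← ENNReal.ofReal_mul (by positivity), ← Real.rpow_add h0, add_neg_cancel,
      Real.rpow_zero, ENNReal.ofReal_one, mul_one]
  have h3 := ENNReal.rpow_le_rpow (h2.trans h1) hp0.le
  rw [ENNReal.mul_rpow_of_nonneg _ _ hp0.le, ← ENNReal.rpow_mul, ← ENNReal.rpow_mul,
    one_div_mul_cancel hp0.ne', ENNReal.rpow_one] at h3
  refine (h3.trans_eq (mul_comm _ _)).trans (mul_le_mul' ?_ (le_of_eq ?_))
  · have h4 : ∫⁻ ρ in Ioo a r, ENNReal.ofReal ((1 - ρ) ^ (-c)) ^ p.conjExponent ≤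
        ENNReal.ofReal ((1 - a) ^ (ε / (p - 1)) / (ε / (p - 1))) := by
      rw [← lintegral_Ioo_one_sub_rpow (by linarith) (by positivity)]
      refine le_trans (lintegral_mono_set (Ioo_subset_Ioo_right hr.le)) (le_of_eq ?_)
      refine setLIntegral_congr_fun measurableSet_Ioo fun ρ hρ => ?_
      have h0 : 0 < 1 - ρ := by linarith [hρ.2]
      rw [ENNReal.ofReal_rpow_of_nonneg (by positivity) hq0.le, ← Real.rpow_mul h0.le]
      congr 2
      rw [hqe, hc]
      field_simp
      ring
    have h5 : 1 / p.conjExponent * p = p - 1 := by rw [hqe]; field_simp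
    rw [h5]
    refine (ENNReal.rpow_le_rpow h4 hp1.le).trans_eq ?_
    have h6 : 0 ≤ 1 - a := by linarith
    rw [ENNReal.ofReal_rpow_of_nonneg (by positivity) hp1.le, Real.div_rpow (by positivity)
      (by positivity), ← Real.rpow_mul h6, div_mul_cancel₀ _ hp1.ne',
      Real.div_rpow hε.le hp1.le, Real.div_rpow hp1.le hε.le]
    congr 1
    field_simp
  · refine setLIntegral_congr_fun measurableSet_Ioo fun ρ hρ => ?_
    have h0 : 0 < 1 - ρ := by linarith [hρ.2]
    rw [ENNReal.mul_rpow_of_nonneg _ _ hp0.le, ENNReal.ofReal_rpow_of_nonneg (by positivity) hp0.le,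
      ← Real.rpow_mul h0.le, hc, div_mul_cancel₀ _ hp0.ne']

/-- The sub-mean value property is used on the disc of radius `(1 - ρ) / 2` about `ρ ζ`, where `(1 -
ρ) / 2 < 1 - ‖w‖`. The disc is then described by conditions suited to Fubini: the first indicator is
kept for the integration in `z`, the second for that in `ρ`. The cap has room for it, since `3/2 h +
4 h < 6 h`. -/
lemma enorm_deriv_radial_le {f : ℂ → ℂ} (hf : DifferentiableOn ℂ f disc) {p : ℝ} (hp : 1 < p)
    (e : ℝ) {θ h : ℝ} (h0 : 0 < h) (h1 : h ≤ 1) {z : ℂ} (hz : z ∈ tent θ h) {ρ : ℝ}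
    (hρ : ρ ∈ Ioo (1 - h) ‖z‖) :
    ‖deriv f (ρ * (z / (‖z‖ : ℂ)))‖ₑ ^ p * ENNReal.ofReal ((1 - ρ) ^ (e + 2)) ≤
      2 * ENNReal.ofReal (2 ^ |e|) *
        ∫⁻ w in {w : ℂ | ‖w‖ < 1 ∧ ‖w - Complex.exp (θ * Complex.I)‖ < 6 * h},
          ‖deriv f w‖ₑ ^ p * ENNReal.ofReal ((1 - ‖w‖) ^ e) *
            {w : ℂ | ‖z - w‖ < 3 * (1 - ‖w‖)}.indicator 1 w *
            {w : ℂ | 1 - 2 * (1 - ‖w‖) < ρ}.indicator 1 w := by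
  have hz0 := ne_zero_of_mem_tent h1 hz
  have hζ := norm_div_norm hz0
  have hzζ := (norm_sub_lt_of_mem_tent h0 h1 hz).2
  set ζ := z / (‖z‖ : ℂ) with hζdef
  have hzz : z = ‖z‖ * ζ := by
    rw [hζdef, mul_div_cancel₀]
    simpa using hz0
  have hρ0 : 0 < ρ := by linarith [hρ.1]
  have hρ1 : 0 < 1 - ρ := by linarith [hρ.2, hz.2.1]
  have hn : ‖(ρ * ζ : ℂ)‖ = ρ := by
    rw [norm_mul, hζ, mul_one, Complex.norm_real, Real.norm_eq_abs, abs_of_pos hρ0]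
  have h2 := enorm_deriv_rpow_mul_le hf hp (z := ρ * ζ) (by linarith)
  rw [hn] at h2
  calc _ = ‖deriv f (ρ * ζ)‖ₑ ^ p * ENNReal.ofReal ((1 - ρ) ^ (2 : ℝ)) *
        ENNReal.ofReal ((1 - ρ) ^ e) := by
        rw [add_comm, Real.rpow_add hρ1, ENNReal.ofReal_mul (by positivity), mul_assoc]
    _ ≤ 2 * (∫⁻ w in ball (ρ * ζ : ℂ) ((1 - ρ) / 2), ‖deriv f w‖ₑ ^ p) *
        ENNReal.ofReal ((1 - ρ) ^ e) := mul_le_mul_left h2 _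
    _ = 2 * ∫⁻ w in ball (ρ * ζ : ℂ) ((1 - ρ) / 2),
        ‖deriv f w‖ₑ ^ p * ENNReal.ofReal ((1 - ρ) ^ e) := by
        rw [mul_assoc, lintegral_mul_const' _ _ ENNReal.ofReal_ne_top]
    _ ≤ 2 * ∫⁻ w in ball (ρ * ζ : ℂ) ((1 - ρ) / 2), ENNReal.ofReal (2 ^ |e|) *
        (‖deriv f w‖ₑ ^ p * ENNReal.ofReal ((1 - ‖w‖) ^ e) *
            {w : ℂ | ‖z - w‖ < 3 * (1 - ‖w‖)}.indicator 1 w *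
            {w : ℂ | 1 - 2 * (1 - ‖w‖) < ρ}.indicator 1 w) := by
        refine mul_le_mul_right (setLIntegral_mono' measurableSet_ball fun w hw => ?_) _
        rw [mem_ball, dist_eq_norm] at hw
        have h3 := norm_sub_norm_le w (ρ * ζ)
        have h4 := norm_sub_norm_le (ρ * ζ) w
        rw [norm_sub_rev, hn] at h4
        rw [hn] at h3
        have h5 : ‖z - ρ * ζ‖ = ‖z‖ - ρ := by
          conv_lhs => rw [hzz]
          rw [← sub_mul, norm_mul, hζ, mul_one, ← Complex.ofReal_sub, Complex.norm_real,
            Real.norm_eq_abs, abs_of_pos (by linarith [hρ.2])]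
        have h6 := norm_sub_le_norm_sub_add_norm_sub z (ρ * ζ) w
        rw [norm_sub_rev (ρ * ζ : ℂ) w] at h6
        rw [indicator_of_mem (show w ∈ {w : ℂ | ‖z - w‖ < 3 * (1 - ‖w‖)} from
            (by linarith [hz.2.1] : ‖z - w‖ < 3 * (1 - ‖w‖))),
          indicator_of_mem (show w ∈ {w : ℂ | 1 - 2 * (1 - ‖w‖) < ρ} from
            (by linarith : 1 - 2 * (1 - ‖w‖) < ρ)), Pi.one_apply, mul_one,
          mul_one, mul_left_comm, ← ENNReal.ofReal_mul (by positivity)]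
        refine mul_le_mul_right (ENNReal.ofReal_le_ofReal ?_) _
        exact rpow_le_rpow_abs_mul_rpow hρ1 (by linarith) one_le_two (by linarith) (by linarith) _
    _ ≤ _ := by
        rw [lintegral_const_mul' _ _ ENNReal.ofReal_ne_top, ← mul_assoc]
        refine mul_le_mul_right (lintegral_mono_set fun w hw => ?_) _
        rw [mem_ball, dist_eq_norm] at hw
        have h3 := norm_sub_norm_le w (ρ * ζ)
        rw [hn] at h3
        have h5 : ‖(ρ * ζ : ℂ) - ζ‖ = 1 - ρ := by
          rw [show (ρ * ζ : ℂ) - ζ = ((ρ - 1 : ℝ) : ℂ) * ζ by push_cast; ring, norm_mul, hζ,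
            mul_one, Complex.norm_real, Real.norm_eq_abs, abs_of_neg (by linarith)]
          ring
        have h6 := norm_sub_le_norm_sub_add_norm_sub w (ρ * ζ) ζ
        have h7 := norm_sub_le_norm_sub_add_norm_sub w ζ (Complex.exp (θ * Complex.I))
        exact ⟨by linarith, by linarith [hρ.1]⟩

/-- The oscillation of `f` along radii, at a point of a tent, is controlled by an area integral. -/
lemma enorm_sub_rpow_le_area {f : ℂ → ℂ} (hf : DifferentiableOn ℂ f disc) {p ε : ℝ} (hp : 1 < p)
    (hε : 0 < ε) {θ h : ℝ} (h0 : 0 < h) (h1 : h ≤ 1) {z : ℂ} (hz : z ∈ tent θ h) :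
    ‖f z - f ((1 - h : ℝ) * (z / (‖z‖ : ℂ)))‖ₑ ^ p ≤
      ENNReal.ofReal (4 * 2 ^ |p - 3 - ε| * ((p - 1) / ε) ^ (p - 1) * h ^ ε) *
        ∫⁻ w in {w : ℂ | ‖w‖ < 1 ∧ ‖w - Complex.exp (θ * Complex.I)‖ < 6 * h},
          ‖deriv f w‖ₑ ^ p * ENNReal.ofReal ((1 - ‖w‖) ^ (p - 2 - ε)) *
            {w : ℂ | ‖z - w‖ < 3 * (1 - ‖w‖)}.indicator 1 w := by
  have hz0 := ne_zero_of_mem_tent h1 hz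
  have hζ := norm_div_norm hz0
  have hzz : (‖z‖ : ℂ) * (z / (‖z‖ : ℂ)) = z := mul_div_cancel₀ _ (by simpa using hz0)
  have hp1 : 0 < p - 1 := by linarith
  have e1 := enorm_radial_sub_rpow_le hf hζ (by linarith : 0 ≤ 1 - h) hz.1.le hz.2.1 hp hε
  rw [hzz, sub_sub_cancel] at e1
  set R : Set ℂ := {w : ℂ | ‖w‖ < 1 ∧ ‖w - Complex.exp (θ * Complex.I)‖ < 6 * h} with hR
  have hRm : MeasurableSet R := measurableSet_cap _ _
  set G : ℂ → ℝ≥0∞ := fun w => ‖deriv f w‖ₑ ^ p * ENNReal.ofReal ((1 - ‖w‖) ^ (p - 3 - ε)) *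
    {w : ℂ | ‖z - w‖ < 3 * (1 - ‖w‖)}.indicator 1 w with hG
  have hdm := measurable_deriv f
  have hSm : MeasurableSet {w : ℂ | ‖z - w‖ < 3 * (1 - ‖w‖)} :=
    measurableSet_lt (measurable_id.const_sub z).norm (by fun_prop)
  have hGm : Measurable G := by
    have : Measurable ({w : ℂ | ‖z - w‖ < 3 * (1 - ‖w‖)}.indicator (1 : ℂ → ℝ≥0∞)) :=
      measurable_one.indicator hSm
    fun_prop
  have hkm : Measurable (Function.uncurry fun (ρ : ℝ) (w : ℂ) =>
      G w * {w : ℂ | 1 - 2 * (1 - ‖w‖) < ρ}.indicator 1 w) := by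
    have hs : MeasurableSet {x : ℝ × ℂ | 1 - 2 * (1 - ‖x.2‖) < x.1} :=
      measurableSet_lt (by fun_prop) (by fun_prop)
    exact (hGm.comp measurable_snd).mul ((measurable_one (α := ℝ≥0∞)).indicator hs)
  have e2 : ∫⁻ ρ in Ioo (1 - h) ‖z‖,
      ‖deriv f (ρ * (z / (‖z‖ : ℂ)))‖ₑ ^ p * ENNReal.ofReal ((1 - ρ) ^ (p - 1 - ε)) ≤
      ENNReal.ofReal (2 * 2 ^ |p - 3 - ε|) * ∫⁻ w in R, G w * ENNReal.ofReal (2 * (1 - ‖w‖)) := by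
    calc _ ≤ ∫⁻ ρ in Ioo (1 - h) ‖z‖, ENNReal.ofReal (2 * 2 ^ |p - 3 - ε|) *
          ∫⁻ w in R, G w * {w : ℂ | 1 - 2 * (1 - ‖w‖) < ρ}.indicator 1 w := by
          refine setLIntegral_mono' measurableSet_Ioo fun ρ hρ => ?_
          have := enorm_deriv_radial_le hf hp (p - 3 - ε) h0 h1 hz hρ
          rw [show p - 3 - ε + 2 = p - 1 - ε by ring] at this
          rwa [ENNReal.ofReal_mul (by norm_num), ENNReal.ofReal_ofNat]
      _ = ENNReal.ofReal (2 * 2 ^ |p - 3 - ε|) * ∫⁻ w in R, ∫⁻ ρ in Ioo (1 - h) ‖z‖,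
          G w * {w : ℂ | 1 - 2 * (1 - ‖w‖) < ρ}.indicator 1 w := by
          rw [lintegral_const_mul' _ _ ENNReal.ofReal_ne_top,
            lintegral_lintegral_swap hkm.aemeasurable]
      -- For fixed `w` the admissible `ρ` lie in an interval of length `2 * (1 - ‖w‖)`. This raises
      -- the weight exponent from `p - 3 - ε` to `p - 2 - ε`.
      _ ≤ _ := by
          refine mul_le_mul_right (setLIntegral_mono' hRm fun w hw => ?_) _
          rw [lintegral_const_mul _ (by
            exact (measurable_one (α := ℝ≥0∞)).indicator
              (measurableSet_lt measurable_const measurable_id :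
                MeasurableSet {ρ : ℝ | 1 - 2 * (1 - ‖w‖) < ρ}))]
          refine mul_le_mul_right ?_ _
          calc ∫⁻ ρ in Ioo (1 - h) ‖z‖, {w : ℂ | 1 - 2 * (1 - ‖w‖) < ρ}.indicator 1 w
              = ∫⁻ ρ in Ioo (1 - h) ‖z‖, (Ioi (1 - 2 * (1 - ‖w‖))).indicator 1 ρ := rfl
            _ ≤ ∫⁻ ρ in Iio 1, (Ioi (1 - 2 * (1 - ‖w‖))).indicator 1 ρ :=
              lintegral_mono_set fun ρ hρ => hρ.2.trans hz.2.1
            _ = ENNReal.ofReal (2 * (1 - ‖w‖)) := by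
              rw [lintegral_indicator_one measurableSet_Ioi,
                Measure.restrict_apply measurableSet_Ioi, Ioi_inter_Iio, Real.volume_Ioo,
                sub_sub_cancel]
  refine (e1.trans (mul_le_mul_right e2 _)).trans_eq ?_
  have e3 : ∫⁻ w in R, G w * ENNReal.ofReal (2 * (1 - ‖w‖)) = ENNReal.ofReal 2 *
      ∫⁻ w in R, ‖deriv f w‖ₑ ^ p * ENNReal.ofReal ((1 - ‖w‖) ^ (p - 2 - ε)) *
            {w : ℂ | ‖z - w‖ < 3 * (1 - ‖w‖)}.indicator 1 w := by
    rw [← lintegral_const_mul' _ _ ENNReal.ofReal_ne_top]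
    refine setLIntegral_congr_fun hRm fun w hw => ?_
    have h2 : 0 < 1 - ‖w‖ := by linarith [hw.1]
    simp only [hG]
    rw [show p - 2 - ε = p - 3 - ε + 1 by ring, Real.rpow_add h2, Real.rpow_one,
      ENNReal.ofReal_mul (by norm_num), ENNReal.ofReal_mul (by positivity)]
    ring
  rw [e3, ← mul_assoc, ← mul_assoc, ← ENNReal.ofReal_mul (by positivity),
    ← ENNReal.ofReal_mul (by positivity)]
  congr 2
  ring

/-! ### Sufficiency of the Carleson condition -/

/-- The area bound is used with `ε = s - t`, and Fubini lets `μ` act first on the balls `‖z - w‖ < 3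
* (1 - ‖w‖)`. These reach the circle, so their measure is governed by the Carleson norm. -/
lemma lintegral_tent_sub_le {f : ℂ → ℂ} (hf : DifferentiableOn ℂ f disc) {α s t p : ℝ}
    (hα : 1 < α) (ht : 0 < t) (hts : t < s) (hp : 1 < p) {μ : Measure ℂ}
    (hμ : IsCarlesonMeasure (s + p * (α - 1)) μ) {θ h : ℝ} (h0 : 0 < h) (h1 : h ≤ 1) :
    ∫⁻ z in tent θ h, ‖f z - f ((1 - h : ℝ) * (z / (‖z‖ : ℂ)))‖ₑ ^ p ∂μ ≤
      ENNReal.ofReal (4 * 2 ^ |p - 3 - (s - t)| * ((p - 1) / (s - t)) ^ (p - 1) *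
        6 ^ (s + p * (α - 1)) * (2 ^ |p * α - 2 + t| * 98 ^ t) * h ^ s) *
        carlesonNorm (s + p * (α - 1)) μ * fNorm p (p * α - 2) t f ^ p := by
  have hp1 : 0 < p - 1 := by linarith
  have hp0 : 0 < p := by linarith
  have hε : 0 < s - t := by linarith
  have hα1 : 0 < α - 1 := by linarith
  set σ := s + p * (α - 1) with hσ
  have hσ0 : 0 < σ := by have := ht.trans hts; positivity
  set ε := s - t with hεd
  set M := carlesonNorm σ μ with hM
  have hMt : M ≠ ∞ := ne_of_lt hμ
  set R : Set ℂ := {w : ℂ | ‖w‖ < 1 ∧ ‖w - Complex.exp (θ * Complex.I)‖ < 6 * h} with hR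
  have hRm : MeasurableSet R := measurableSet_cap _ _
  have hTm := measurableSet_tent θ h
  -- `μ` is not assumed σ-finite; the Carleson bound makes it finite on each tent, which justifies
  -- exchanging the integrals.
  have : IsFiniteMeasure (μ.restrict (tent θ h)) := by
    refine isFiniteMeasure_restrict.2 (ne_of_lt ?_)
    exact (measure_tent_le σ μ θ h0 h1).trans_lt (ENNReal.mul_lt_top hμ ENNReal.ofReal_lt_top)
  set G : ℂ → ℝ≥0∞ := fun w => ‖deriv f w‖ₑ ^ p * ENNReal.ofReal ((1 - ‖w‖) ^ (p - 2 - ε)) with hG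
  have hdm := measurable_deriv f
  have hGm : Measurable G := by fun_prop
  have hkm : Measurable (Function.uncurry fun (z : ℂ) (w : ℂ) =>
      G w * {w : ℂ | ‖z - w‖ < 3 * (1 - ‖w‖)}.indicator 1 w) := by
    have hs : MeasurableSet {x : ℂ × ℂ | ‖x.1 - x.2‖ < 3 * (1 - ‖x.2‖)} :=
      measurableSet_lt (by fun_prop) (by fun_prop)
    exact (hGm.comp measurable_snd).mul ((measurable_one (α := ℝ≥0∞)).indicator hs)
  set c : ℝ := 4 * 2 ^ |p - 3 - ε| * ((p - 1) / ε) ^ (p - 1) with hc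
  have hc0 : 0 ≤ c := by positivity
  calc _ ≤ ∫⁻ z in tent θ h, ENNReal.ofReal (c * h ^ ε) *
        (∫⁻ w in R, G w * {w : ℂ | ‖z - w‖ < 3 * (1 - ‖w‖)}.indicator 1 w) ∂μ :=
        setLIntegral_mono' hTm fun z hz => enorm_sub_rpow_le_area hf hp hε h0 h1 hz
    _ = ENNReal.ofReal (c * h ^ ε) * ∫⁻ w in R, ∫⁻ z in tent θ h,
        G w * {w : ℂ | ‖z - w‖ < 3 * (1 - ‖w‖)}.indicator 1 w ∂μ := by
        rw [lintegral_const_mul' _ _ ENNReal.ofReal_ne_top,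
          lintegral_lintegral_swap hkm.aemeasurable]
    _ ≤ ENNReal.ofReal (c * h ^ ε) * ∫⁻ w in R, ENNReal.ofReal (6 ^ σ) * M *
        (‖deriv f w‖ₑ ^ p * ENNReal.ofReal ((1 - ‖w‖) ^ (p * α - 2 + t))) := by
        refine mul_le_mul_right (setLIntegral_mono' hRm fun w hw => ?_) _
        have hw1 : 0 < 1 - ‖w‖ := by linarith [hw.1]
        have hSm : MeasurableSet {z : ℂ | ‖z - w‖ < 3 * (1 - ‖w‖)} :=
          measurableSet_lt (measurable_id.sub_const w).norm measurable_const
        rw [lintegral_const_mul _ (by exact (measurable_one (α := ℝ≥0∞)).indicator hSm)]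
        calc G w * ∫⁻ z in tent θ h, {w : ℂ | ‖z - w‖ < 3 * (1 - ‖w‖)}.indicator 1 w ∂μ
            = G w * ∫⁻ z in tent θ h, {z : ℂ | ‖z - w‖ < 3 * (1 - ‖w‖)}.indicator 1 z ∂μ := rfl
          _ ≤ G w * (M * ENNReal.ofReal ((2 * (3 * (1 - ‖w‖))) ^ σ)) := by
            rw [lintegral_indicator_one hSm, Measure.restrict_apply hSm]
            refine mul_le_mul_right ((measure_mono fun z hz => ?_).trans
              (measure_ball_le hσ0.le μ hw.1 (by linarith : 1 - ‖w‖ ≤ 3 * (1 - ‖w‖)))) _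
            exact ⟨ne_zero_of_mem_tent h1 hz.2, hz.2.2.1, hz.1⟩
          _ = _ := by
            -- The exponents match here: the factor `(1 - ‖w‖) ^ σ` restores the weight of the cap
            -- estimate.
            rw [show p * α - 2 + t = p - 2 - ε + σ by rw [hεd, hσ]; ring, Real.rpow_add hw1,
              ← mul_assoc 2 3, show (2 * 3 : ℝ) = 6 by norm_num,
              Real.mul_rpow (by norm_num) hw1.le, ENNReal.ofReal_mul (by positivity),
              ENNReal.ofReal_mul (by positivity)]
            ring
    _ ≤ ENNReal.ofReal (c * h ^ ε) * (ENNReal.ofReal (6 ^ σ) * M *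
        (ENNReal.ofReal (2 ^ |p * α - 2 + t| * 98 ^ t) * ENNReal.ofReal (h ^ t) *
          fNorm p (p * α - 2) t f ^ p)) := by
        rw [lintegral_const_mul' _ _ (ENNReal.mul_ne_top ENNReal.ofReal_ne_top hMt)]
        gcongr
        exact lintegral_cap_le_fNorm hp0 ht f θ h0 h1
    _ = _ := by
        rw [show h ^ s = h ^ ε * h ^ t by rw [← Real.rpow_add h0, hεd, sub_add_cancel],
          show c * 6 ^ σ * (2 ^ |p * α - 2 + t| * 98 ^ t) * (h ^ ε * h ^ t) =
            (c * h ^ ε) * (6 ^ σ * ((2 ^ |p * α - 2 + t| * 98 ^ t) * h ^ t)) by ring,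
          ENNReal.ofReal_mul (p := c * h ^ ε) (by positivity),
          ENNReal.ofReal_mul (p := 6 ^ σ) (by positivity),
          ENNReal.ofReal_mul (p := 2 ^ |p * α - 2 + t| * 98 ^ t) (by positivity)]
        ring

lemma tentNorm_rpow_le {s p : ℝ} (hp : 0 < p) {μ : Measure ℂ} {f : ℂ → ℂ} {B : ℝ≥0∞}
    (hB : ∀ θ h : ℝ, 0 < h → h ≤ 1 →
      ∫⁻ z in tent θ h, ‖f z‖ₑ ^ p ∂μ ≤ B ^ p * ENNReal.ofReal (h ^ s)) :
    tentNorm s p μ f ≤ B := by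
  have h1 : (⨆ (θ : ℝ) (h ∈ Set.Ioc (0 : ℝ) 1),
    (∫⁻ z in tent θ h, ‖f z‖ₑ ^ p ∂μ) / ENNReal.ofReal (h ^ s)) ≤ B ^ p :=
    iSup_le fun θ => iSup₂_le fun h hh => ENNReal.div_le_of_le_mul (hB θ h hh.1 hh.2)
  refine (ENNReal.rpow_le_rpow h1 (by positivity)).trans_eq ?_
  rw [← ENNReal.rpow_mul, mul_one_div_cancel hp.ne', ENNReal.rpow_one]

lemma isBoundedEmbedding_of_isCarlesonMeasure {α s t p : ℝ} (hα : 1 < α) (ht : 0 < t)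
    (hts : t < s) (hp : 1 < p) {μ : Measure ℂ} (hμ : IsCarlesonMeasure (s + p * (α - 1)) μ) :
    IsBoundedEmbedding p (p * α - 2) t s μ := by
  have hp0 : 0 < p := by linarith
  obtain ⟨K, hK0, hK⟩ := exists_norm_le_growth hα ht hp
  have hMt : carlesonNorm (s + p * (α - 1)) μ ≠ ∞ := ne_of_lt hμ
  set c : ℝ := 4 * 2 ^ |p - 3 - (s - t)| * ((p - 1) / (s - t)) ^ (p - 1) *
        6 ^ (s + p * (α - 1)) * (2 ^ |p * α - 2 + t| * 98 ^ t) with hc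
  have hc0 : 0 ≤ c := by
    have : 0 < p - 1 := by linarith
    have : 0 < s - t := by linarith
    positivity
  -- The factor `2 ^ (p - 1)` is from convexity of the `p`-th power; `c` bounds the oscillation and
  -- `K ^ p` the values at the bottom of the tent.
  set D : ℝ≥0∞ := 2 ^ (p - 1) * (ENNReal.ofReal c + ENNReal.ofReal (K ^ p)) *
    carlesonNorm (s + p * (α - 1)) μ with hD
  have hDt : D ≠ ∞ := by
    refine ENNReal.mul_ne_top (ENNReal.mul_ne_top ?_ ?_) hMt
    · exact ENNReal.rpow_ne_top_of_nonneg (by linarith) (by simp)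
    · exact ENNReal.add_ne_top.2 ⟨ENNReal.ofReal_ne_top, ENNReal.ofReal_ne_top⟩
  have hD2 : D ^ (1 / p) ≠ ∞ := ENNReal.rpow_ne_top_of_nonneg (by positivity) hDt
  have key : ∀ f ∈ fSpace p (p * α - 2) t,
      tentNorm s p μ f ≤ D ^ (1 / p) * fNorm p (p * α - 2) t f := by
    intro f hf
    refine tentNorm_rpow_le hp0 fun θ h h0 h1 => ?_
    have hg : ∀ z ∈ tent θ h, ‖f ((1 - h : ℝ) * (z / (‖z‖ : ℂ)))‖ₑ ^ p ≤
        ENNReal.ofReal (K ^ p * h ^ (p * (1 - α))) * fNorm p (p * α - 2) t f ^ p := by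
      intro z hz
      have h2 := hK f hf _ (norm_div_norm (ne_zero_of_mem_tent h1 hz)) (1 - h) (by linarith)
        (by linarith)
      rw [sub_sub_cancel] at h2
      rw [← ofReal_norm, ENNReal.ofReal_rpow_of_nonneg (norm_nonneg _) hp0.le]
      have h3 := Real.rpow_le_rpow (norm_nonneg _) h2 hp0.le
      refine (ENNReal.ofReal_le_ofReal h3).trans_eq ?_
      rw [Real.mul_rpow (by positivity) (by positivity), Real.mul_rpow hK0 (by positivity),
        ← Real.rpow_mul h0.le, mul_right_comm, mul_comm (1 - α),
        ENNReal.ofReal_mul (by positivity),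
        ← ENNReal.ofReal_rpow_of_nonneg ENNReal.toReal_nonneg hp0.le,
        ENNReal.ofReal_toReal hf.2.ne]
    calc ∫⁻ z in tent θ h, ‖f z‖ₑ ^ p ∂μ
        ≤ ∫⁻ z in tent θ h, 2 ^ (p - 1) *
          (‖f z - f ((1 - h : ℝ) * (z / (‖z‖ : ℂ)))‖ₑ ^ p +
            ENNReal.ofReal (K ^ p * h ^ (p * (1 - α))) * fNorm p (p * α - 2) t f ^ p) ∂μ := by
          refine setLIntegral_mono' (measurableSet_tent θ h) fun z hz => ?_
          have h2 : ‖f z‖ₑ ≤ ‖f z - f ((1 - h : ℝ) * (z / (‖z‖ : ℂ)))‖ₑ +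
              ‖f ((1 - h : ℝ) * (z / (‖z‖ : ℂ)))‖ₑ := by
            conv_lhs => rw [← sub_add_cancel (f z) (f ((1 - h : ℝ) * (z / (‖z‖ : ℂ))))]
            exact enorm_add_le _ _
          refine (ENNReal.rpow_le_rpow h2 hp0.le).trans
            ((ENNReal.rpow_add_le_mul_rpow_add_rpow _ _ hp.le).trans ?_)
          gcongr
          exact hg z hz
      _ = 2 ^ (p - 1) *
          (∫⁻ z in tent θ h, ‖f z - f ((1 - h : ℝ) * (z / (‖z‖ : ℂ)))‖ₑ ^ p ∂μ +
            ENNReal.ofReal (K ^ p * h ^ (p * (1 - α))) * fNorm p (p * α - 2) t f ^ p *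
              μ (tent θ h)) := by
          rw [lintegral_const_mul' _ _ (ENNReal.rpow_ne_top_of_nonneg (by linarith) (by simp)),
            lintegral_add_right _ measurable_const, setLIntegral_const]
      _ ≤ 2 ^ (p - 1) * (ENNReal.ofReal (c * h ^ s) *
            carlesonNorm (s + p * (α - 1)) μ * fNorm p (p * α - 2) t f ^ p +
            ENNReal.ofReal (K ^ p * h ^ (p * (1 - α))) * fNorm p (p * α - 2) t f ^ p *
            (carlesonNorm (s + p * (α - 1)) μ * ENNReal.ofReal (h ^ (s + p * (α - 1))))) := by
          gcongr
          · exact lintegral_tent_sub_le hf.1 hα ht hts hp hμ h0 h1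
          · exact measure_tent_le _ μ θ h0 h1
      _ = (D ^ (1 / p) * fNorm p (p * α - 2) t f) ^ p * ENNReal.ofReal (h ^ s) := by
          rw [ENNReal.mul_rpow_of_nonneg _ _ hp0.le, ← ENNReal.rpow_mul,
            one_div_mul_cancel hp0.ne', ENNReal.rpow_one, hD,
            show h ^ s = h ^ (p * (1 - α)) * h ^ (s + p * (α - 1)) by
              rw [← Real.rpow_add h0]; congr 1; ring,
            ENNReal.ofReal_mul hc0, ENNReal.ofReal_mul (p := h ^ (p * (1 - α))) (by positivity),
            ENNReal.ofReal_mul (p := K ^ p) (by positivity)]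
          ring
  refine ⟨fun f hf => ⟨hf.1, (key f hf).trans_lt ?_⟩, (D ^ (1 / p)).toNNReal, fun f hf => ?_⟩
  · exact ENNReal.mul_lt_top (lt_top_iff_ne_top.2 hD2) hf.2
  · rw [ENNReal.coe_toNNReal hD2]
    exact key f hf

/-! ### A Forelli–Rudin estimate -/

lemma lintegral_Ioi_rpow_mul_max_le {A j k : ℝ} (hA : 0 < A) (hj : 0 < j) (hk : j < k) :
    ∫⁻ x in Ioi (0 : ℝ), ENNReal.ofReal (x ^ (j - 1) * (max A x) ^ (-k)) ≤
      ENNReal.ofReal ((1 / j + 1 / (k - j)) * A ^ (j - k)) := by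
  have hkj : 0 < k - j := by linarith
  have h1 : ∫⁻ x in Ioo 0 A, ENNReal.ofReal (x ^ (j - 1) * (max A x) ^ (-k)) =
      ENNReal.ofReal (1 / j * A ^ (j - k)) := by
    have : ∫⁻ x in Ioo 0 A, ENNReal.ofReal (x ^ (j - 1) * (max A x) ^ (-k)) =
        ∫⁻ x in Ioo 0 A, ENNReal.ofReal (x ^ (j - 1)) * ENNReal.ofReal (A ^ (-k)) := by
      refine setLIntegral_congr_fun measurableSet_Ioo fun x hx => ?_
      have hx0 : 0 < x := hx.1
      rw [max_eq_left hx.2.le, ENNReal.ofReal_mul (by positivity)]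
    rw [this, lintegral_mul_const' _ _ ENNReal.ofReal_ne_top, lintegral_Ioo_rpow hA.le hj,
      ← ENNReal.ofReal_mul (by positivity), sub_eq_add_neg, Real.rpow_add hA]
    congr 1
    ring
  have h2 : ∫⁻ x in Ioi A, ENNReal.ofReal (x ^ (j - 1) * (max A x) ^ (-k)) =
      ENNReal.ofReal (1 / (k - j) * A ^ (j - k)) := by
    have : ∫⁻ x in Ioi A, ENNReal.ofReal (x ^ (j - 1) * (max A x) ^ (-k)) =
        ∫⁻ x in Ioi A, ENNReal.ofReal (x ^ (j - 1 - k)) := by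
      refine setLIntegral_congr_fun measurableSet_Ioi fun x hx => ?_
      have hx0 : 0 < x := hA.trans hx
      rw [max_eq_right (le_of_lt hx), ← Real.rpow_add hx0, sub_eq_add_neg (j - 1)]
    rw [this, ← ofReal_integral_eq_lintegral_ofReal
      (integrableOn_Ioi_rpow_of_lt (by linarith) hA), integral_Ioi_rpow_of_lt (by linarith) hA]
    · congr 1
      rw [show j - 1 - k + 1 = -(k - j) by ring, show j - k = -(k - j) by ring]
      field_simp
    · filter_upwards [ae_restrict_mem measurableSet_Ioi] with x hx
      exact Real.rpow_nonneg (hA.trans hx).le _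
  rw [add_mul, ENNReal.ofReal_add (by positivity) (by positivity), ← h1, ← h2,
    ← Ioc_union_Ioi_eq_Ioi hA.le, setLIntegral_congr Ioo_ae_eq_Ioc]
  exact lintegral_union_le _ _ _

lemma lintegral_comp_abs_eq (F : ℝ → ℝ≥0∞) :
    ∫⁻ x : ℝ, F |x| = 2 * ∫⁻ x in Ioi (0 : ℝ), F x := by
  have h1 : ∫⁻ x in Ioi (0 : ℝ), F |x| = ∫⁻ x in Ioi (0 : ℝ), F x :=
    setLIntegral_congr_fun measurableSet_Ioi fun x hx => by rw [abs_of_pos hx]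
  have h2 : ∫⁻ x in Iio (0 : ℝ), F |x| = ∫⁻ x in Ioi (0 : ℝ), F |x| := by
    rw [← lintegral_indicator measurableSet_Iio, ← lintegral_indicator measurableSet_Ioi,
      ← lintegral_neg_eq_self ((Ioi (0 : ℝ)).indicator _)]
    refine lintegral_congr fun x => ?_
    by_cases hx : x < 0
    · rw [indicator_of_mem (show x ∈ Iio (0 : ℝ) from hx),
        indicator_of_mem (show -x ∈ Ioi (0 : ℝ) from neg_pos.2 hx), abs_neg]
    · rw [indicator_of_notMem (show x ∉ Iio (0 : ℝ) from hx), indicator_of_notMem]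
      exact fun h => hx (neg_pos.1 h)
  rw [← lintegral_add_compl _ measurableSet_Ioi (μ := volume) (A := Ioi (0 : ℝ)), compl_Ioi,
    ← setLIntegral_congr Iio_ae_eq_Iic, h2, h1, two_mul]

/-- Both `1 - x` and the chord `‖e^(iθ) - 1‖` are controlled: the chord is at most `(1 - x) + ‖1 - x
e^(iθ)‖`, hence at most twice the norm, and `|θ|` is at most `π / 2` times the chord. -/
lemma max_le_pi_mul_norm {x θ : ℝ} (hx0 : 0 ≤ x) (hx1 : x ≤ 1) (hθ : |θ| ≤ Real.pi) :
    max (1 - x) |θ| ≤ Real.pi * ‖1 - x * Complex.exp (θ * Complex.I)‖ := by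
  have h1 : 1 - x ≤ ‖1 - x * Complex.exp (θ * Complex.I)‖ := by
    have := norm_sub_norm_le 1 (x * Complex.exp (θ * Complex.I))
    rwa [norm_one, norm_mul, Complex.norm_exp_ofReal_mul_I, mul_one, Complex.norm_real,
      Real.norm_eq_abs, abs_of_nonneg hx0] at this
  have h2 := abs_sub_le_norm_exp_sub_exp (x := θ) (y := 0) (by rwa [sub_zero])
  rw [sub_zero, Complex.ofReal_zero, zero_mul, Complex.exp_zero] at h2
  have h3 := norm_sub_le_norm_sub_add_norm_sub (Complex.exp (θ * Complex.I))
    (x * Complex.exp (θ * Complex.I)) 1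
  rw [norm_sub_rev (x * Complex.exp (θ * Complex.I)) 1, show Complex.exp (θ * Complex.I) - x * Complex.exp (θ * Complex.I) =
    ((1 - x : ℝ) : ℂ) * Complex.exp (θ * Complex.I) by push_cast; ring, norm_mul,
    Complex.norm_exp_ofReal_mul_I, mul_one, Complex.norm_real, Real.norm_eq_abs,
    abs_of_nonneg (by linarith)] at h3
  have hpi := Real.pi_gt_three
  refine max_le ?_ ?_
  · nlinarith [norm_nonneg (1 - x * Complex.exp (θ * Complex.I))]
  · nlinarith

lemma lintegral_angle_le {x m A : ℝ} (hx0 : 0 ≤ x) (hA : 0 < A) (hx : A ≤ 1 - x) (hm : 1 < m) :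
    ∫⁻ θ in Ioo (-Real.pi) Real.pi,
      ENNReal.ofReal (‖1 - x * Complex.exp (θ * Complex.I)‖ ^ (-m)) ≤
    ENNReal.ofReal (2 * Real.pi ^ m * (1 + 1 / (m - 1)) * A ^ (1 - m)) := by
  have hpi := Real.pi_pos
  calc _ ≤ ∫⁻ θ in Ioo (-Real.pi) Real.pi,
        ENNReal.ofReal (Real.pi ^ m) * ENNReal.ofReal ((max A |θ|) ^ (-m)) := by
        refine setLIntegral_mono' measurableSet_Ioo fun θ hθ => ?_
        have h1 := max_le_pi_mul_norm hx0 (by linarith) (abs_le.2 ⟨hθ.1.le, hθ.2.le⟩)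
        have h2 : 0 < max A |θ| := lt_max_of_lt_left hA
        have h3 : max A |θ| / Real.pi ≤ ‖1 - x * Complex.exp (θ * Complex.I)‖ := by
          rw [div_le_iff₀' hpi]
          exact (max_le_max_right _ hx).trans h1
        rw [← ENNReal.ofReal_mul (by positivity)]
        refine ENNReal.ofReal_le_ofReal ((Real.rpow_le_rpow_of_nonpos (by positivity) h3
          (by linarith)).trans_eq ?_)
        rw [Real.div_rpow h2.le hpi.le, Real.rpow_neg hpi.le, div_inv_eq_mul, mul_comm]
    _ ≤ ∫⁻ θ : ℝ, ENNReal.ofReal (Real.pi ^ m) * ENNReal.ofReal ((max A |θ|) ^ (-m)) :=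
        setLIntegral_le_lintegral _ _
    _ = ENNReal.ofReal (Real.pi ^ m) * (2 * ∫⁻ θ in Ioi (0 : ℝ),
        ENNReal.ofReal (θ ^ ((1 : ℝ) - 1) * (max A θ) ^ (-m))) := by
        rw [lintegral_const_mul' _ _ ENNReal.ofReal_ne_top,
          lintegral_comp_abs_eq fun x => ENNReal.ofReal ((max A x) ^ (-m))]
        simp
    _ ≤ ENNReal.ofReal (Real.pi ^ m) * (2 *
        ENNReal.ofReal ((1 / 1 + 1 / (m - 1)) * A ^ (1 - m))) := by
        gcongr
        exact lintegral_Ioi_rpow_mul_max_le hA one_pos hm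
    _ = _ := by
        have : 0 < m - 1 := by linarith
        rw [show (2 : ℝ≥0∞) = ENNReal.ofReal 2 by simp, ← ENNReal.ofReal_mul (by norm_num),
          ← ENNReal.ofReal_mul (by positivity)]
        congr 1
        ring

/-- A Forelli–Rudin type estimate, for a real parameter. -/
lemma lintegral_forelliRudin_real {c m r : ℝ} (hc : -1 < c) (hm : c + 2 < m) (hr0 : 0 ≤ r)
    (hr1 : r < 1) :
    ∫⁻ w in disc, ENNReal.ofReal ((1 - ‖w‖) ^ c * ‖1 - r * w‖ ^ (-m)) ≤
      ENNReal.ofReal (2 * Real.pi ^ m * (1 + 1 / (m - 1)) *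
        ((1 / (c + 1) + 1 / (m - 1 - (c + 1))) * (1 - r) ^ (c + 2 - m))) := by
  have hm1 : 0 < m - 1 := by linarith
  have hc1 : 0 < c + 1 := by linarith
  have hpi := Real.pi_pos
  set D : ℝ := 2 * Real.pi ^ m * (1 + 1 / (m - 1)) with hD
  have hD0 : 0 ≤ D := by positivity
  rw [disc, lintegral_ball_eq_polar (by fun_prop)]
  calc _ ≤ ∫⁻ ρ in Ioo (0 : ℝ) 1, ENNReal.ofReal D *
        ENNReal.ofReal ((1 - ρ) ^ (c + 1 - 1) * (max (1 - r) (1 - ρ)) ^ (-(m - 1))) := by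
        refine setLIntegral_mono' measurableSet_Ioo fun ρ hρ => ?_
        have hρ0 : 0 < ρ := hρ.1
        have hρ1 : 0 < 1 - ρ := by linarith [hρ.2]
        have hmax : 0 < max (1 - r) (1 - ρ) := lt_max_of_lt_right hρ1
        have e1 : ∀ θ : ℝ, ENNReal.ofReal ((1 - ‖(0 : ℂ) + ρ * Complex.exp (θ * Complex.I)‖) ^ c *
            ‖1 - r * ((0 : ℂ) + ρ * Complex.exp (θ * Complex.I))‖ ^ (-m)) =
            ENNReal.ofReal ((1 - ρ) ^ c) *
            ENNReal.ofReal (‖1 - ((r * ρ : ℝ) : ℂ) * Complex.exp (θ * Complex.I)‖ ^ (-m)) := by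
          intro θ
          rw [zero_add, norm_mul, Complex.norm_exp_ofReal_mul_I, mul_one, Complex.norm_real,
            Real.norm_eq_abs, abs_of_pos hρ0, ENNReal.ofReal_mul (by positivity), ← mul_assoc,
            ← Complex.ofReal_mul]
        simp only [e1]
        rw [lintegral_const_mul' _ _ ENNReal.ofReal_ne_top]
        -- Since `r * ρ` is below both `r` and `ρ`, `1 - r * ρ` is at least both `1 - r` and `1 -
        -- ρ`. The Jacobian `ρ ≤ 1` is then dropped, leaving a one-dimensional integral in `1 - ρ`.
        have e2 := lintegral_angle_le (x := r * ρ) (m := m) (A := max (1 - r) (1 - ρ))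
          (by positivity) hmax
          (max_le (by nlinarith) (by nlinarith)) (by linarith)
        have e3 : ENNReal.ofReal ρ ≤ 1 := ENNReal.ofReal_le_one.2 hρ.2.le
        refine (mul_le_mul' e3 (mul_le_mul_right e2 _)).trans_eq ?_
        rw [one_mul, ← ENNReal.ofReal_mul (by positivity), ← ENNReal.ofReal_mul hD0,
          add_sub_cancel_right, neg_sub]
        congr 1
        ring
    _ ≤ ENNReal.ofReal D * ∫⁻ x in Ioi (0 : ℝ),
        ENNReal.ofReal (x ^ (c + 1 - 1) * (max (1 - r) x) ^ (-(m - 1))) := by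
        rw [lintegral_const_mul' _ _ ENNReal.ofReal_ne_top]
        refine mul_le_mul_right ?_ _
        rw [← lintegral_indicator measurableSet_Ioo, ← lintegral_indicator measurableSet_Ioi,
          ← lintegral_sub_left_eq_self ((Ioi (0 : ℝ)).indicator _) (1 : ℝ)]
        refine lintegral_mono fun x => ?_
        by_cases hx : x ∈ Ioo (0 : ℝ) 1
        · have hx' : 1 - x ∈ Ioi (0 : ℝ) := sub_pos.2 hx.2
          rw [indicator_of_mem hx, indicator_of_mem hx']
        · rw [indicator_of_notMem hx]
          exact zero_le
    _ ≤ _ := by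
        rw [ENNReal.ofReal_mul hD0]
        refine mul_le_mul_right ((lintegral_Ioi_rpow_mul_max_le (by linarith) hc1
          (by linarith)).trans_eq ?_) _
        congr 3
        ring

/-- Rotation invariance of area reduces to a real parameter `1 - h / 2`, so the constant does not
depend on `θ`. -/
lemma lintegral_forelliRudin {c m : ℝ} (hc : -1 < c) (hm : c + 2 < m) :
    ∃ C : ℝ, 0 ≤ C ∧ ∀ θ h : ℝ, 0 < h → h ≤ 1 →
      ∫⁻ w in disc, ENNReal.ofReal ((1 - ‖w‖) ^ c *
        ‖1 - (starRingEnd ℂ) (center θ h) * w‖ ^ (-m)) ≤ ENNReal.ofReal (C * h ^ (c + 2 - m)) := by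
  have hm1 : 0 < m - 1 := by linarith
  have hc1 : 0 < c + 1 := by linarith
  have hmc : 0 < m - 1 - (c + 1) := by linarith
  have hpi := Real.pi_pos
  refine ⟨2 * Real.pi ^ m * (1 + 1 / (m - 1)) *
        ((1 / (c + 1) + 1 / (m - 1 - (c + 1))) * (1 / 2) ^ (c + 2 - m)), by positivity,
        fun θ h h0 h1 => ?_⟩
  have h2 := lintegral_forelliRudin_real hc hm (r := 1 - h / 2) (by linarith) (by linarith)
  rw [sub_sub_cancel, show h / 2 = 1 / 2 * h by ring, Real.mul_rpow (by norm_num) h0.le,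
    ← mul_assoc (_ + _), ← mul_assoc] at h2
  refine le_trans (le_of_eq ?_) h2
  have hmp := (rotation (Circle.exp θ)).measurePreserving
  have h3 := hmp.setLIntegral_comp_preimage_emb
    (rotation (Circle.exp θ)).toHomeomorph.measurableEmbedding
    (fun w => ENNReal.ofReal ((1 - ‖w‖) ^ c *
        ‖1 - (starRingEnd ℂ) (center θ h) * w‖ ^ (-m))) disc
  have h4 : (rotation (Circle.exp θ)) ⁻¹' disc = disc := by
    ext w
    rw [mem_preimage, disc, mem_ball_zero_iff, mem_ball_zero_iff, LinearIsometryEquiv.norm_map]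
  rw [← h3, h4]
  refine lintegral_congr fun w => ?_
  rw [LinearIsometryEquiv.norm_map, rotation_apply, Circle.coe_exp, center, norm_one_sub_conj_mul]
  congr 3
  rw [show Complex.exp (θ * Complex.I) - ((1 - h / 2 : ℝ) : ℂ) * (Complex.exp (θ * Complex.I) * w) =
    Complex.exp (θ * Complex.I) * (1 - ((1 - 1 / 2 * h : ℝ) : ℂ) * w) by push_cast; ring,
    norm_mul, Complex.norm_exp_ofReal_mul_I, one_mul]

/-! ### Test functions and necessity of the Carleson condition -/

/-- The test functions `h (1 - conj b z)^(-α)`, `b = (1 - h / 2) exp (i θ)`. -/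
def testFun (α θ h : ℝ) (z : ℂ) : ℂ :=
  h * (1 - (starRingEnd ℂ) (center θ h) * z) ^ ((-α : ℝ) : ℂ)

lemma norm_testFun (α θ : ℝ) {h : ℝ} (h0 : 0 ≤ h) (z : ℂ) :
    ‖testFun α θ h z‖ = h * ‖1 - (starRingEnd ℂ) (center θ h) * z‖ ^ (-α) := by
  rw [testFun, norm_mul, Complex.norm_real, Real.norm_eq_abs, abs_of_nonneg h0,
    Complex.norm_cpow_real]

lemma hasDerivAt_testFun (α θ : ℝ) {h : ℝ} (h0 : 0 < h) (h1 : h ≤ 1) {z : ℂ} (hz : ‖z‖ < 1) :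
    HasDerivAt (testFun α θ h) (h * (((-α : ℝ) : ℂ) *
      (1 - (starRingEnd ℂ) (center θ h) * z) ^ (((-α - 1 : ℝ) : ℂ)) *
      -(starRingEnd ℂ) (center θ h))) z := by
  -- The real part is positive, so the principal branch of the power is holomorphic on the disc.
  have hs : 1 - (starRingEnd ℂ) (center θ h) * z ∈ Complex.slitPlane := by
    refine Or.inl ?_
    have h2 := Complex.re_le_norm ((starRingEnd ℂ) (center θ h) * z)
    rw [norm_mul, RCLike.norm_conj, norm_center θ h1] at h2
    rw [Complex.sub_re, Complex.one_re]
    nlinarith [norm_nonneg z]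
  have h3 : HasDerivAt (fun z => 1 - (starRingEnd ℂ) (center θ h) * z)
      (-(starRingEnd ℂ) (center θ h)) z := by
    simpa using ((hasDerivAt_id z).const_mul ((starRingEnd ℂ) (center θ h))).const_sub 1
  have h4 := (h3.cpow_const (c := ((-α : ℝ) : ℂ)) hs).const_mul (h : ℂ)
  refine h4.congr_deriv ?_
  push_cast
  rfl

lemma norm_deriv_testFun_le {α : ℝ} (hα : 0 ≤ α) (θ : ℝ) {h : ℝ} (h0 : 0 < h) (h1 : h ≤ 1) {z : ℂ}
    (hz : ‖z‖ < 1) : ‖deriv (testFun α θ h) z‖ ≤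
      h * α * ‖1 - (starRingEnd ℂ) (center θ h) * z‖ ^ (-(α + 1)) := by
  rw [(hasDerivAt_testFun α θ h0 h1 hz).deriv, norm_mul, norm_mul, norm_mul, norm_neg,
    RCLike.norm_conj, norm_center θ h1, Complex.norm_cpow_real, Complex.norm_real,
    Complex.norm_real, Real.norm_eq_abs, Real.norm_eq_abs, abs_neg, abs_of_nonneg hα,
    abs_of_pos h0, show -α - 1 = -(α + 1) by ring, ← mul_assoc, ← mul_assoc]
  exact mul_le_of_le_one_right (by positivity) (by linarith)

/-- The Möbius factor is at most `1`, which removes the supremum over `a`. The remaining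
Forelli–Rudin integral is `O(h ^ (-p))`, cancelled by the factor `h ^ p` of the normalization. -/
lemma exists_fNorm_testFun_le {α t p : ℝ} (hα : 1 < α) (ht : 0 < t) (hp : 1 < p) :
    ∃ C : ℝ≥0, ∀ θ h : ℝ, 0 < h → h ≤ 1 →
      fNorm p (p * α - 2) t (testFun α θ h) ≤ C := by
  have hp0 : 0 < p := by linarith
  have hα0 : 0 < α := by linarith
  obtain ⟨C, hC0, hC⟩ := lintegral_forelliRudin (c := p * α - 2) (m := (α + 1) * p)
    (by nlinarith) (by nlinarith)
  have hB : ENNReal.ofReal (α ^ p * 2 ^ |p * α - 2| * C) ^ (1 / p) ≠ ∞ :=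
    ENNReal.rpow_ne_top_of_nonneg (by positivity) ENNReal.ofReal_ne_top
  refine ⟨1 + (ENNReal.ofReal (α ^ p * 2 ^ |p * α - 2| * C) ^ (1 / p)).toNNReal,
    fun θ h h0 h1 => ?_⟩
  rw [ENNReal.coe_add, ENNReal.coe_one, ENNReal.coe_toNNReal hB]
  refine add_le_add ?_ (iSup₂_le fun a ha => ENNReal.rpow_le_rpow ?_ (by positivity))
  · rw [← ofReal_norm, norm_testFun α θ h0.le, mul_zero, sub_zero, norm_one, Real.one_rpow, mul_one]
    exact ENNReal.ofReal_le_one.2 h1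
  calc _ ≤ ∫⁻ z in disc, ENNReal.ofReal ((h * α) ^ p * 2 ^ |p * α - 2|) *
        ENNReal.ofReal ((1 - ‖z‖) ^ (p * α - 2) *
          ‖1 - (starRingEnd ℂ) (center θ h) * z‖ ^ (-((α + 1) * p))) := by
        refine setLIntegral_mono' measurableSet_ball fun z hz => ?_
        have hz1 : ‖z‖ < 1 := mem_ball_zero_iff.1 hz
        have ha1 : ‖a‖ < 1 := mem_ball_zero_iff.1 ha
        have hzn := norm_nonneg z
        have hzs : 0 < 1 - ‖z‖ ^ 2 := by nlinarith
        have has : 0 < 1 - ‖a‖ ^ 2 := by nlinarith [norm_nonneg a]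
        rw [← ENNReal.ofReal_mul (by positivity)]
        apply ENNReal.ofReal_le_ofReal
        have e1 : (1 - ‖mobius a z‖ ^ 2) ^ t ≤ 1 := by
          refine Real.rpow_le_one ?_ (by nlinarith [norm_nonneg (mobius a z)]) ht.le
          rw [one_sub_norm_mobius_sq ha1 hz1]
          positivity
        have e2 : (1 - ‖z‖ ^ 2) ^ (p * α - 2) ≤ 2 ^ |p * α - 2| * (1 - ‖z‖) ^ (p * α - 2) :=
          rpow_le_rpow_abs_mul_rpow hzs (by linarith) one_le_two (by nlinarith) (by nlinarith) _
        have e3 : ‖deriv (testFun α θ h) z‖ ^ p ≤ (h * α) ^ p *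
            ‖1 - (starRingEnd ℂ) (center θ h) * z‖ ^ (-((α + 1) * p)) := by
          refine (Real.rpow_le_rpow (norm_nonneg _) (norm_deriv_testFun_le hα0.le θ h0 h1 hz1)
            hp0.le).trans_eq ?_
          rw [Real.mul_rpow (by positivity) (by positivity), ← Real.rpow_mul (norm_nonneg _),
            neg_mul]
        calc _ ≤ ‖deriv (testFun α θ h) z‖ ^ p * (1 - ‖z‖ ^ 2) ^ (p * α - 2) :=
              mul_le_of_le_one_right (by positivity) e1
          _ ≤ _ := mul_le_mul e3 e2 (by positivity) (by positivity)
          _ = _ := by ring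
    _ ≤ ENNReal.ofReal ((h * α) ^ p * 2 ^ |p * α - 2|) *
        ENNReal.ofReal (C * h ^ (p * α - 2 + 2 - (α + 1) * p)) := by
        rw [lintegral_const_mul' _ _ ENNReal.ofReal_ne_top]
        exact mul_le_mul_right (hC θ h h0 h1) _
    _ = _ := by
        rw [← ENNReal.ofReal_mul (by positivity), show p * α - 2 + 2 - (α + 1) * p = -p by ring,
          Real.rpow_neg h0.le, Real.mul_rpow h0.le hα0.le]
        congr 1
        have : 0 < h ^ p := by positivity
        field_simp

lemma isCarlesonMeasure_of_isBoundedEmbedding {α s t p : ℝ} (hα : 1 < α) (ht : 0 < t)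
    (hp : 1 < p) {μ : Measure ℂ} (hμ : IsBoundedEmbedding p (p * α - 2) t s μ) :
    IsCarlesonMeasure (s + p * (α - 1)) μ := by
  have hp0 : 0 < p := by linarith
  obtain ⟨C, hC⟩ := exists_fNorm_testFun_le hα ht hp
  obtain ⟨-, K, hK⟩ := hμ
  set B : ℝ≥0∞ := K * C with hB
  have hBp : B ^ p ≠ ∞ :=
    ENNReal.rpow_ne_top_of_nonneg hp0.le (ENNReal.mul_ne_top ENNReal.coe_ne_top ENNReal.coe_ne_top)
  have key : carlesonNorm (s + p * (α - 1)) μ ≤ B ^ p * ENNReal.ofReal (6 ^ (α * p)) := by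
    refine iSup_le fun θ => iSup₂_le fun h hh => ENNReal.div_le_of_le_mul ?_
    obtain ⟨h0, h1⟩ := hh
    have hmem : testFun α θ h ∈ fSpace p (p * α - 2) t := by
      refine ⟨fun z hz => ?_, (hC θ h h0 h1).trans_lt ENNReal.coe_lt_top⟩
      exact (hasDerivAt_testFun α θ h0 h1 (mem_ball_zero_iff.1 hz)).differentiableAt
        |>.differentiableWithinAt
    have h2 : tentNorm s p μ (testFun α θ h) ≤ B :=
      (hK _ hmem).trans (mul_le_mul_right (hC θ h h0 h1) _)
    have h3 := ENNReal.rpow_le_rpow h2 hp0.le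
    rw [tentNorm, ← ENNReal.rpow_mul, one_div_mul_cancel hp0.ne', ENNReal.rpow_one] at h3
    have h4 : (∫⁻ z in tent θ h, ‖testFun α θ h z‖ₑ ^ p ∂μ) / ENNReal.ofReal (h ^ s) ≤ B ^ p :=
      (le_iSup_of_le θ (le_iSup₂_of_le (f := fun h (_ : h ∈ Ioc (0 : ℝ) 1) =>
        (∫⁻ z in tent θ h, ‖testFun α θ _ z‖ₑ ^ p ∂μ) / ENNReal.ofReal (h ^ s)) h ⟨h0, h1⟩
          le_rfl)).trans h3
    rw [ENNReal.div_le_iff (by simpa using Real.rpow_pos_of_pos h0 s) ENNReal.ofReal_ne_top] at h4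
    -- On the tent `‖1 - conj b * z‖ ≤ 5 * h + h` with `b = center θ h`, so the test function has
    -- modulus at least `h * (6 * h) ^ (-α)` there.
    have h5 : ENNReal.ofReal ((h * (6 * h) ^ (-α)) ^ p) * μ (tent θ h) ≤
        ∫⁻ z in tent θ h, ‖testFun α θ h z‖ₑ ^ p ∂μ := by
      rw [← setLIntegral_const]
      refine setLIntegral_mono' (measurableSet_tent θ h) fun z hz => ?_
      rw [← ofReal_norm, ENNReal.ofReal_rpow_of_nonneg (norm_nonneg _) hp0.le]
      refine ENNReal.ofReal_le_ofReal (Real.rpow_le_rpow (by positivity) ?_ hp0.le)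
      rw [norm_testFun α θ h0.le]
      refine mul_le_mul_of_nonneg_left (Real.rpow_le_rpow_of_nonpos ?_ ?_ (by linarith)) h0.le
      · refine norm_pos_iff.2 (one_sub_conj_mul_ne_zero ?_ hz.2.1.le)
        rw [norm_center θ h1]
        linarith
      · have h6 := norm_one_sub_conj_center_mul_le θ h0 hz.2.1.le
        have h7 := (norm_sub_lt_of_mem_tent h0 h1 hz).1
        linarith
    have h8 := h5.trans h4
    have h9 : 0 < (h * (6 * h) ^ (-α)) ^ p := by positivity
    calc μ (tent θ h) = ENNReal.ofReal (((h * (6 * h) ^ (-α)) ^ p)⁻¹) *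
          (ENNReal.ofReal ((h * (6 * h) ^ (-α)) ^ p) * μ (tent θ h)) := by
          rw [← mul_assoc, ← ENNReal.ofReal_mul (by positivity), inv_mul_cancel₀ h9.ne',
            ENNReal.ofReal_one, one_mul]
      _ ≤ ENNReal.ofReal (((h * (6 * h) ^ (-α)) ^ p)⁻¹) * (B ^ p * ENNReal.ofReal (h ^ s)) :=
          mul_le_mul_right h8 _
      _ = B ^ p * ENNReal.ofReal (((h * (6 * h) ^ (-α)) ^ p)⁻¹ * h ^ s) := by
          rw [ENNReal.ofReal_mul (by positivity)]
          ring
      _ = _ := by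
          rw [mul_assoc, ← ENNReal.ofReal_mul (by positivity)]
          congr 2
          rw [Real.mul_rpow (by norm_num) h0.le, mul_left_comm, Real.mul_rpow (by positivity)
            (by positivity), ← Real.rpow_mul (by norm_num), mul_inv, neg_mul,
            Real.rpow_neg (by norm_num) (α * p), inv_inv, mul_assoc,
            Real.mul_rpow h0.le (by positivity), ← Real.rpow_mul h0.le, ← Real.rpow_add h0,
            ← Real.rpow_neg h0.le, ← Real.rpow_add h0]
          congr 2
          ring
  exact key.trans_lt (ENNReal.mul_lt_top (lt_top_iff_ne_top.2 hBp) ENNReal.ofReal_lt_top)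

end CarlesonEmbedding

end

theorem mainTheorem3 (α s t p : ℝ) (hα : 1 < α) (ht : 0 < t) (hts : t < s) (hp : 1 < p)
    (μ : MeasureTheory.Measure ℂ) (hμ : μ (CarlesonEmbedding.disc)ᶜ = 0) :
    CarlesonEmbedding.IsBoundedEmbedding p (p * α - 2) t s μ ↔
      CarlesonEmbedding.IsCarlesonMeasure (s + p * (α - 1)) μ :=
  ⟨CarlesonEmbedding.isCarlesonMeasure_of_isBoundedEmbedding hα ht hp,
    CarlesonEmbedding.isBoundedEmbedding_of_isCarlesonMeasure hα ht hts hp⟩
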